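/- Let $N\in\mathbb N$ and let $\omega:[0,\infty)\to[0,\infty)$ be a non-quasianalytic weight function, i.e. a continuous increasing (meaning non-decreasing) function such that - $(\alpha)$ there is $K\ge 1$ with $\omega(2t)\le K(1+\omega(t))$ for all $t\ge 0$; - $(\beta)$ $\int_1^\infty \frac{\omega(t)}{1+t^2}\,dt<\infty$; - $(\gamma)$ there are $a\in\mathbb R$, $b>0$ with $\omega(t)\ge a+b\log(1+t)$ for all $t\ge 0$; - $(\delta)$ $\varphi_\omega:=\omega\circ\exp$ is convex on $\mathbb R$. Put $\omega(x):=\omega(|x|)$ for $x\in\mathbb R^N$ and $\varphi^*_\omega(s):=\sup_{t\ge 0}\{st-\varphi_\omega(t)\}\in(-\infty,+\infty]$ for $s\ge 0$, with the convention $\exp(-\infty)=0$. Let $\mathcal S_\omega(\mathbb R^N)$ be the space of all $f\in L^1(\mathbb R^N)$ such that $f,\hat f\in C^\infty(\mathbb R^N)$ and $\|\exp(\lambda\omega)\partial^\alpha f\|_\infty<\infty$, $\|\exp(\lambda\omega)\partial^\alpha\hat f\|_\infty<\infty$ for all $\lambda>0$ and all $\alpha\in\mathbb N_0^N$, endowed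 with the topology generated by the norms $$q_{\lambda,\mu}(f):=\sup_{\alpha\in\mathbb N_0^N}\|\exp(\mu\omega)\partial^\alpha f\|_\infty\exp\left(-\lambda\varphi^*_\omega\left(\tfrac{|\alpha|}{\lambda}\right)\right),\qquad \lambda,\mu>0.$$ For integers $m,n\ge 1$ let $\mathcal O^m_{n,\omega}(\mathbb R^N)$ be the space of all $f\in C^\infty(\mathbb R^N)$ with $$r_{m,n}(f):=\sup_{\alpha\in\mathbb N_0^N}\sup_{x\in\mathbb R^N}|\partial^\alpha f(x)|\exp\left(-n\omega(x)-m\varphi^*_\omega\left(\tfrac{|\alpha|}{m}\right)\right)<\infty,$$ normed by $r_{m,n}$. Let $\mathcal O^m_\omega(\mathbb R^N):=\bigcup_{n}\mathcal O^m_{n,\omega}(\mathbb R^N)$ with the locally convex inductive limit topology, and let $\mathcal O_{M,\omega}(\mathbb R^N):=\bigcap_{m}\mathcal O^m_\omega(\mathbb R^N)$ with the projective limit topology of the spaces $\mathcal O^m_\omega(\mathbb R^N)$. Then $fg\in\mathcal S_\omega(\mathbb R^N)$ for all $f\in\mathcal O_{M,\omega}(\mathbb R^N)$ and $g\in\mathcal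 S_\omega(\mathbb R^N)$, and the bilinear multiplication map $$M:\mathcal O_{M,\omega}(\mathbb R^N)\times\mathcal S_\omega(\mathbb R^N)\to\mathcal S_\omega(\mathbb R^N),\qquad (f,g)\mapsto fg,$$ is separately continuous and hypocontinuous. The latter means that for every bounded set $A\subset\mathcal O_{M,\omega}(\mathbb R^N)$ the set $\{M(f,\cdot):f\in A\}$ is an equicontinuous set of continuous linear maps $\mathcal S_\omega(\mathbb R^N)\to\mathcal S_\omega(\mathbb R^N)$, and for every bounded set $B\subset\mathcal S_\omega(\mathbb R^N)$ the set $\{M(\cdot,g):g\in B\}$ is an equicontinuous set of continuous linear maps $\mathcal O_{M,\omega}(\mathbb R^N)\to\mathcal S_\omega(\mathbb R^N)$. -/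

import Mathlib

open Set Filter Topology MeasureTheory
open scoped ENNReal FourierTransform

noncomputable section

/-! ## Weight functions -/

/-- Non-quasianalytic weight functions `ω : [0,∞) → [0,∞)` (in the sense of Braun, Meise and
Taylor, Beurling case). The function is given on `ℝ`, but only its values on `[0,∞)` matter. -/
structure IsNonQuasianalyticWeight (ω : ℝ → ℝ) : Prop where
  continuousOn : ContinuousOn ω (Ici 0)
  monotoneOn : MonotoneOn ω (Ici 0)
  nonneg : ∀ t, 0 ≤ t → 0 ≤ ω t
  alpha : ∃ K : ℝ, 1 ≤ K ∧ ∀ t, 0 ≤ t → ω (2 * t) ≤ K * (1 + ω t)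
  beta : IntegrableOn (fun t => ω t / (1 + t ^ 2)) (Ioi 1)
  gamma : ∃ a b : ℝ, 0 < b ∧ ∀ t, 0 ≤ t → a + b * Real.log (1 + t) ≤ ω t
  delta : ConvexOn ℝ univ (fun t => ω (Real.exp t))

/-- The Young conjugate `φ*(s) = sup_{t ≥ 0} (s t - φ(t))` of `φ = ω ∘ exp`. It is extended
real valued: for `ω(t) = log(1 + t)` it is `+∞` for `s > 1`. -/
def youngConj (ω : ℝ → ℝ) (s : ℝ) : EReal :=
  ⨆ (t : ℝ) (_ : 0 ≤ t), ((s * t - ω (Real.exp t) : ℝ) : EReal)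

/-! ## Partial derivatives and the weighted norms -/

/-- `ℝ^N` with its Euclidean norm. -/
abbrev RN (N : ℕ) : Type := EuclideanSpace ℝ (Fin N)

/-- `f ∈ C^∞(ℝ^N)`. -/
abbrev IsSmooth {N : ℕ} (f : RN N → ℂ) : Prop := ContDiff ℝ ((⊤ : ℕ∞) : WithTop ℕ∞) f

/-- The partial derivative `∂_i f`. -/
def pderivRN {N : ℕ} (i : Fin N) (f : RN N → ℂ) : RN N → ℂ :=
  fun x => fderiv ℝ f x (EuclideanSpace.single i 1)

/-- `∂^α f = ∂_1^{α_1} ⋯ ∂_N^{α_N} f`. It is only used for smooth `f`. -/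
def mderiv {N : ℕ} (α : Fin N → ℕ) (f : RN N → ℂ) : RN N → ℂ :=
  (List.finRange N).foldr (fun i g => (pderivRN i)^[α i] g) f

/-- `sup_α sup_x |∂^α f(x)| exp(μ ω(x) - lam φ*(|α| / lam))`, in `[0,∞]`,
where `ω(x)` means `ω(|x|)`, and `exp(-∞) = 0`. -/
def weightedSup {N : ℕ} (ω : ℝ → ℝ) (lam μ : ℝ) (f : RN N → ℂ) : ℝ≥0∞ :=
  ⨆ (α : Fin N → ℕ) (x : RN N), ‖mderiv α f x‖ₑ *
    EReal.exp (((μ * ω ‖x‖ : ℝ) : EReal) - (lam : EReal) * youngConj ω ((∑ i, α i : ℕ) / lam))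

/-- The norms `q_{lam,μ}` of `S_ω(ℝ^N)`. -/
def qNorm {N : ℕ} (ω : ℝ → ℝ) (lam μ : ℝ) (f : RN N → ℂ) : ℝ≥0∞ :=
  weightedSup ω lam μ f

/-- The norms `r_{m,n}` of the spaces `O^m_{n,ω}(ℝ^N)`. -/
def rNorm {N : ℕ} (ω : ℝ → ℝ) (m n : ℕ+) (f : RN N → ℂ) : ℝ≥0∞ :=
  weightedSup ω (m : ℝ) (-(n : ℝ)) f

/-! Algebraic facts needed to see that the spaces below are vector spaces. -/

section Facts

variable {N : ℕ}

theorem contDiff_pderivRN (i : Fin N) {f : RN N → ℂ} (hf : IsSmooth f) :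
    IsSmooth (pderivRN i f) :=
  (hf.fderiv_right (m := ((⊤ : ℕ∞) : WithTop ℕ∞)) (by simp)).clm_apply contDiff_const

theorem pderivRN_add (i : Fin N) {f g : RN N → ℂ} (hf : IsSmooth f)
    (hg : IsSmooth g) : pderivRN i (f + g) = pderivRN i f + pderivRN i g := by
  funext x
  simp [pderivRN, fderiv_add (hf.differentiable (by simp) x) (hg.differentiable (by simp) x)]

theorem pderivRN_smul (i : Fin N) (c : ℂ) {f : RN N → ℂ} (hf : IsSmooth f) :
    pderivRN i (c • f) = c • pderivRN i f := by
  funext x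
  simp [pderivRN, fderiv_const_smul (hf.differentiable (by simp) x) c]

theorem iter_pderivRN (i : Fin N) (k : ℕ) {f g : RN N → ℂ} (c : ℂ) (hf : IsSmooth f)
    (hg : IsSmooth g) :
    IsSmooth ((pderivRN i)^[k] f) ∧
    (pderivRN i)^[k] (f + g) = (pderivRN i)^[k] f + (pderivRN i)^[k] g ∧
    (pderivRN i)^[k] (c • f) = c • (pderivRN i)^[k] f := by
  induction k generalizing f g with
  | zero => exact ⟨hf, rfl, rfl⟩
  | succ k ih =>
    have h := ih (contDiff_pderivRN i hf) (contDiff_pderivRN i hg)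
    simp only [Function.iterate_succ, Function.comp_apply]
    rw [pderivRN_add i hf hg, pderivRN_smul i c hf]
    exact h

theorem mderiv_aux (α : Fin N → ℕ) (l : List (Fin N)) {f g : RN N → ℂ} (c : ℂ)
    (hf : IsSmooth f) (hg : IsSmooth g) :
    IsSmooth (l.foldr (fun i g => (pderivRN i)^[α i] g) f) ∧
    l.foldr (fun i g => (pderivRN i)^[α i] g) (f + g) =
      l.foldr (fun i g => (pderivRN i)^[α i] g) f +
        l.foldr (fun i g => (pderivRN i)^[α i] g) g ∧
    l.foldr (fun i g => (pderivRN i)^[α i] g) (c • f) =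
      c • l.foldr (fun i g => (pderivRN i)^[α i] g) f := by
  induction l with
  | nil => exact ⟨hf, rfl, rfl⟩
  | cons i l ih =>
    have hg' : IsSmooth (l.foldr (fun i g => (pderivRN i)^[α i] g) g) := by
      clear ih
      induction l with
      | nil => exact hg
      | cons j l ih => exact (iter_pderivRN j (α j) 0 ih ih).1
    have h := iter_pderivRN i (α i) c ih.1 hg'
    simp only [List.foldr_cons]
    rw [ih.2.1, ih.2.2]
    exact h

theorem mderiv_add (α : Fin N → ℕ) {f g : RN N → ℂ} (hf : IsSmooth f)
    (hg : IsSmooth g) : mderiv α (f + g) = mderiv α f + mderiv α g :=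
  (mderiv_aux α _ 0 hf hg).2.1

theorem mderiv_smul (α : Fin N → ℕ) (c : ℂ) {f : RN N → ℂ} (hf : IsSmooth f) :
    mderiv α (c • f) = c • mderiv α f :=
  (mderiv_aux α _ c hf hf).2.2

theorem mderiv_zero (α : Fin N → ℕ) : mderiv α (0 : RN N → ℂ) = 0 := by
  have h := mderiv_smul α (0 : ℂ) (f := (0 : RN N → ℂ)) contDiff_const
  simpa using h

theorem weightedSup_add_le (ω : ℝ → ℝ) (lam μ : ℝ) {f g : RN N → ℂ} (hf : IsSmooth f)
    (hg : IsSmooth g) :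
    weightedSup ω lam μ (f + g) ≤ weightedSup ω lam μ f + weightedSup ω lam μ g := by
  refine iSup₂_le fun α x => ?_
  rw [mderiv_add α hf hg]
  calc _ ≤ (‖mderiv α f x‖ₑ + ‖mderiv α g x‖ₑ) * _ := by
        gcongr
        exact enorm_add_le _ _
    _ ≤ _ := by
        rw [add_mul]
        exact add_le_add
          (le_iSup₂ (f := fun (α : Fin N → ℕ) (x : RN N) => ‖mderiv α f x‖ₑ * EReal.exp
            (((μ * ω ‖x‖ : ℝ) : EReal) -
              (lam : EReal) * youngConj ω ((∑ i, α i : ℕ) / lam))) α x)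
          (le_iSup₂ (f := fun (α : Fin N → ℕ) (x : RN N) => ‖mderiv α g x‖ₑ * EReal.exp
            (((μ * ω ‖x‖ : ℝ) : EReal) -
              (lam : EReal) * youngConj ω ((∑ i, α i : ℕ) / lam))) α x)

theorem weightedSup_smul (ω : ℝ → ℝ) (lam μ : ℝ) (c : ℂ) {f : RN N → ℂ}
    (hf : IsSmooth f) : weightedSup ω lam μ (c • f) = ‖c‖ₑ * weightedSup ω lam μ f := by
  simp only [weightedSup, mderiv_smul _ c hf, Pi.smul_apply, enorm_smul, ENNReal.mul_iSup,
    mul_assoc]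

theorem weightedSup_zero (ω : ℝ → ℝ) (lam μ : ℝ) :
    weightedSup ω lam μ (0 : RN N → ℂ) = 0 := by
  simp [weightedSup, mderiv_zero]

theorem ereal_exp_mono_sub {a b : ℝ} (h : a ≤ b) (c : EReal) :
    EReal.exp ((a : EReal) - c) ≤ EReal.exp ((b : EReal) - c) :=
  EReal.exp_monotone (EReal.sub_le_sub (EReal.coe_le_coe_iff.2 h) le_rfl)

theorem rNorm_anti {ω : ℝ → ℝ} (hω : ∀ t, 0 ≤ t → 0 ≤ ω t) (m : ℕ+) {n n' : ℕ+} (h : n ≤ n')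
    (f : RN N → ℂ) : rNorm ω m n' f ≤ rNorm ω m n f := by
  refine iSup₂_mono fun α x => ?_
  refine mul_le_mul' le_rfl (ereal_exp_mono_sub ?_ _)
  have h1 : ((n : ℕ) : ℝ) ≤ ((n' : ℕ) : ℝ) := by exact_mod_cast h
  nlinarith [hω ‖x‖ (norm_nonneg x)]

end Facts

/-! ## Topologies -/

/-- The topology defined by a single (extended) seminorm `p`: it is generated by the balls
`{g | p (g - f) < ε}`. -/
@[reducible] def normTopology {X : Type*} [AddCommGroup X] (p : X → ℝ≥0∞) : TopologicalSpace X :=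
  TopologicalSpace.generateFrom {U | ∃ (f : X) (ε : ℝ≥0∞), 0 < ε ∧ U = {g | p (g - f) < ε}}

/-- The locally convex inductive limit topology on `X` with respect to maps `j n : Y n → X`:
the finest locally convex vector space topology making all the `j n` continuous (the infimum,
in Mathlib's order, is the join of all such topologies, which is again one of them). -/
@[reducible] def lcInductiveTopology {ι : Type*} {X : Type*} {Y : ι → Type*} [AddCommGroup X] [Module ℂ X]
    [Module ℝ X] (tY : ∀ n, TopologicalSpace (Y n)) (j : ∀ n, Y n → X) : TopologicalSpace X :=
  sInf {t | @IsTopologicalAddGroup X t _ ∧ @ContinuousSMul ℂ X _ _ t ∧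
    @LocallyConvexSpace ℝ X _ _ _ _ t ∧ ∀ n, @Continuous _ _ (tY n) t (j n)}

/-! ## The space `S_ω(ℝ^N)` -/

/-- `S_ω(ℝ^N)` as a set of functions: `f ∈ L¹`, `f` and its Fourier transform are smooth, and all
`exp(lam ω) ∂^α f` and `exp(lam ω) ∂^α (𝓕 f)` are bounded. -/
def MemS (ω : ℝ → ℝ) (N : ℕ) (f : RN N → ℂ) : Prop :=
  Integrable f ∧ IsSmooth f ∧ IsSmooth (𝓕 f) ∧
    ∀ lam : ℝ, 0 < lam → ∀ α : Fin N → ℕ,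
      (∃ C : ℝ, ∀ x, Real.exp (lam * ω ‖x‖) * ‖mderiv α f x‖ ≤ C) ∧
      (∃ C : ℝ, ∀ ξ, Real.exp (lam * ω ‖ξ‖) * ‖mderiv α (𝓕 f) ξ‖ ≤ C)

theorem fourier_add_RN {N : ℕ} {f g : RN N → ℂ} (hf : Integrable f) (hg : Integrable g) :
    𝓕 (f + g) = 𝓕 f + 𝓕 g := by
  funext ξ
  have h := VectorFourier.fourierIntegral_add (μ := volume) (L := innerₗ (RN N))
    Real.continuous_fourierChar continuous_inner hf hg
  exact (congrFun h ξ)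

theorem fourier_smul_RN {N : ℕ} (c : ℂ) (f : RN N → ℂ) : 𝓕 (c • f) = c • 𝓕 f := by
  funext ξ
  exact congrFun (VectorFourier.fourierIntegral_const_smul Real.fourierChar volume
    (innerₗ (RN N)) f c) ξ

theorem bdd_add_aux {N : ℕ} (w : RN N → ℝ) (f g : RN N → ℂ)
    (hf : ∃ C : ℝ, ∀ x, Real.exp (w x) * ‖f x‖ ≤ C)
    (hg : ∃ C : ℝ, ∀ x, Real.exp (w x) * ‖g x‖ ≤ C) :
    ∃ C : ℝ, ∀ x, Real.exp (w x) * ‖(f + g) x‖ ≤ C := by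
  obtain ⟨C, hC⟩ := hf
  obtain ⟨D, hD⟩ := hg
  refine ⟨C + D, fun x => ?_⟩
  have h1 : Real.exp (w x) * ‖f x + g x‖ ≤ Real.exp (w x) * (‖f x‖ + ‖g x‖) := by
    gcongr
    exact norm_add_le _ _
  have := hC x
  have := hD x
  simp only [Pi.add_apply]
  linarith

theorem bdd_smul_aux {N : ℕ} (w : RN N → ℝ) (c : ℂ) (f : RN N → ℂ)
    (hf : ∃ C : ℝ, ∀ x, Real.exp (w x) * ‖f x‖ ≤ C) :
    ∃ C : ℝ, ∀ x, Real.exp (w x) * ‖(c • f) x‖ ≤ C := by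
  obtain ⟨C, hC⟩ := hf
  refine ⟨‖c‖ * C, fun x => ?_⟩
  have h := mul_le_mul_of_nonneg_left (hC x) (norm_nonneg c)
  simp only [Pi.smul_apply, norm_smul]
  linarith

/-- `S_ω(ℝ^N)` as a linear subspace of the space of all functions. -/
def subS (ω : ℝ → ℝ) (N : ℕ) : Submodule ℂ (RN N → ℂ) where
  carrier := {f | MemS ω N f}
  zero_mem' := by
    have h0 : 𝓕 (0 : RN N → ℂ) = 0 := by
      have h := fourier_smul_RN (0 : ℂ) (0 : RN N → ℂ)
      simpa using h
    refine ⟨integrable_zero _ _ _, contDiff_const, ?_, fun lam _ α => ?_⟩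
    · rw [h0]; exact contDiff_const
    · rw [h0, mderiv_zero]; exact ⟨⟨0, by simp⟩, ⟨0, by simp⟩⟩
  add_mem' := by
    rintro f g ⟨hf1, hf2, hf3, hf4⟩ ⟨hg1, hg2, hg3, hg4⟩
    refine ⟨hf1.add hg1, hf2.add hg2, ?_, fun lam hlam α => ?_⟩
    · rw [fourier_add_RN hf1 hg1]; exact hf3.add hg3
    · rw [fourier_add_RN hf1 hg1, mderiv_add α hf2 hg2, mderiv_add α hf3 hg3]
      exact ⟨bdd_add_aux _ _ _ (hf4 lam hlam α).1 (hg4 lam hlam α).1,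
        bdd_add_aux _ _ _ (hf4 lam hlam α).2 (hg4 lam hlam α).2⟩
  smul_mem' := by
    rintro c f ⟨hf1, hf2, hf3, hf4⟩
    refine ⟨hf1.smul c, hf2.const_smul c, ?_, fun lam hlam α => ?_⟩
    · rw [fourier_smul_RN]; exact hf3.const_smul c
    · rw [fourier_smul_RN, mderiv_smul α c hf2, mderiv_smul α c hf3]
      exact ⟨bdd_smul_aux _ _ _ (hf4 lam hlam α).1, bdd_smul_aux _ _ _ (hf4 lam hlam α).2⟩

/-- The space `S_ω(ℝ^N)`. A `def`, so that it does not carry the topology of pointwise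
convergence. -/
def SpaceS (ω : ℝ → ℝ) (N : ℕ) : Type := ↥(subS ω N)

instance (ω : ℝ → ℝ) (N : ℕ) : AddCommGroup (SpaceS ω N) :=
  inferInstanceAs (AddCommGroup ↥(subS ω N))

instance (ω : ℝ → ℝ) (N : ℕ) : Module ℂ (SpaceS ω N) :=
  inferInstanceAs (Module ℂ ↥(subS ω N))

/-- The function underlying an element of `S_ω(ℝ^N)`. -/
def SpaceS.toFun {ω : ℝ → ℝ} {N : ℕ} (f : SpaceS ω N) : RN N → ℂ := f.1

/-- The topology of `S_ω(ℝ^N)`, generated by the norms `q_{lam,μ}`, `lam, μ > 0`. -/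
instance (ω : ℝ → ℝ) (N : ℕ) : TopologicalSpace (SpaceS ω N) :=
  ⨅ (lam : ℝ) (_ : 0 < lam) (μ : ℝ) (_ : 0 < μ),
    normTopology (fun f : SpaceS ω N => qNorm ω lam μ f.toFun)

/-! ## The space `O_{M,ω}(ℝ^N)` -/

/-- The space `O^m_{n,ω}(ℝ^N)` of all smooth `f` with `r_{m,n}(f) < ∞`. -/
def subOmn (ω : ℝ → ℝ) (N : ℕ) (m n : ℕ+) : Submodule ℂ (RN N → ℂ) where
  carrier := {f | IsSmooth f ∧ rNorm ω m n f < ∞}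
  zero_mem' := ⟨contDiff_const, by rw [rNorm, weightedSup_zero]; exact ENNReal.zero_lt_top⟩
  add_mem' := by
    rintro f g ⟨hf, hf'⟩ ⟨hg, hg'⟩
    exact ⟨hf.add hg, (weightedSup_add_le ω _ _ hf hg).trans_lt (ENNReal.add_lt_top.2 ⟨hf', hg'⟩)⟩
  smul_mem' := by
    rintro c f ⟨hf, hf'⟩
    refine ⟨hf.const_smul c, ?_⟩
    rw [rNorm, weightedSup_smul ω _ _ c hf]
    exact ENNReal.mul_lt_top enorm_lt_top hf'

/-- `O^m_ω(ℝ^N)`, the union of the `O^m_{n,ω}(ℝ^N)`, `n ≥ 1`, written as the sum of these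
subspaces; by `mem_subOm` this is the union. -/
def subOm (ω : ℝ → ℝ) (N : ℕ) (m : ℕ+) : Submodule ℂ (RN N → ℂ) := ⨆ n : ℕ+, subOmn ω N m n

theorem mem_subOm {ω : ℝ → ℝ} (hω : ∀ t, 0 ≤ t → 0 ≤ ω t) (N : ℕ) (m : ℕ+) (f : RN N → ℂ) :
    f ∈ subOm ω N m ↔ ∃ n : ℕ+, f ∈ subOmn ω N m n := by
  refine Submodule.mem_iSup_of_directed _ ?_
  refine directed_of_isDirected_le (r := (· ≤ ·)) fun n n' h f hf => ?_
  exact ⟨hf.1, (rNorm_anti hω m h f).trans_lt hf.2⟩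

/-- `O_{M,ω}(ℝ^N)`, the intersection of the `O^m_ω(ℝ^N)`, `m ≥ 1`. -/
def subOM (ω : ℝ → ℝ) (N : ℕ) : Submodule ℂ (RN N → ℂ) := ⨅ m : ℕ+, subOm ω N m

/-- The normed space `O^m_{n,ω}(ℝ^N)`. -/
def SpaceOmn (ω : ℝ → ℝ) (N : ℕ) (m n : ℕ+) : Type := ↥(subOmn ω N m n)

instance (ω : ℝ → ℝ) (N : ℕ) (m n : ℕ+) : AddCommGroup (SpaceOmn ω N m n) :=
  inferInstanceAs (AddCommGroup ↥(subOmn ω N m n))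

instance (ω : ℝ → ℝ) (N : ℕ) (m n : ℕ+) : TopologicalSpace (SpaceOmn ω N m n) :=
  normTopology (fun f : SpaceOmn ω N m n => rNorm ω m n f.1)

/-- The (LB)-space `O^m_ω(ℝ^N)`. -/
def SpaceOm (ω : ℝ → ℝ) (N : ℕ) (m : ℕ+) : Type := ↥(subOm ω N m)

instance (ω : ℝ → ℝ) (N : ℕ) (m : ℕ+) : AddCommGroup (SpaceOm ω N m) :=
  inferInstanceAs (AddCommGroup ↥(subOm ω N m))

instance (ω : ℝ → ℝ) (N : ℕ) (m : ℕ+) : Module ℂ (SpaceOm ω N m) :=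
  inferInstanceAs (Module ℂ ↥(subOm ω N m))

/-- The inclusion `O^m_{n,ω}(ℝ^N) → O^m_ω(ℝ^N)`. -/
def inclOmn (ω : ℝ → ℝ) (N : ℕ) (m n : ℕ+) (f : SpaceOmn ω N m n) : SpaceOm ω N m :=
  ⟨f.1, le_iSup (subOmn ω N m) n f.2⟩

/-- `O^m_ω(ℝ^N)` carries the locally convex inductive limit topology of the spaces
`O^m_{n,ω}(ℝ^N)`, `n ≥ 1`. -/
instance (ω : ℝ → ℝ) (N : ℕ) (m : ℕ+) : TopologicalSpace (SpaceOm ω N m) :=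
  lcInductiveTopology (fun n : ℕ+ => (inferInstance : TopologicalSpace (SpaceOmn ω N m n)))
    (inclOmn ω N m)

/-- The space `O_{M,ω}(ℝ^N)`. -/
def SpaceOM (ω : ℝ → ℝ) (N : ℕ) : Type := ↥(subOM ω N)

instance (ω : ℝ → ℝ) (N : ℕ) : AddCommGroup (SpaceOM ω N) :=
  inferInstanceAs (AddCommGroup ↥(subOM ω N))

instance (ω : ℝ → ℝ) (N : ℕ) : Module ℂ (SpaceOM ω N) :=
  inferInstanceAs (Module ℂ ↥(subOM ω N))

/-- The function underlying an element of `O_{M,ω}(ℝ^N)`. -/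
def SpaceOM.toFun {ω : ℝ → ℝ} {N : ℕ} (f : SpaceOM ω N) : RN N → ℂ := f.1

/-- The inclusion `O_{M,ω}(ℝ^N) → O^m_ω(ℝ^N)`. -/
def inclOM (ω : ℝ → ℝ) (N : ℕ) (m : ℕ+) (f : SpaceOM ω N) : SpaceOm ω N m :=
  ⟨f.1, iInf_le (subOm ω N) m f.2⟩

/-- `O_{M,ω}(ℝ^N)` carries the projective limit topology of the spaces `O^m_ω(ℝ^N)`, `m ≥ 1`. -/
instance (ω : ℝ → ℝ) (N : ℕ) : TopologicalSpace (SpaceOM ω N) :=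
  ⨅ m : ℕ+, TopologicalSpace.induced (inclOM ω N m) inferInstance

/-! ## Bilinear maps -/

/-- A bilinear map is separately continuous if all its partial maps are continuous. -/
def IsSeparatelyContinuous {E F G : Type*} [AddCommGroup E] [Module ℂ E] [TopologicalSpace E]
    [AddCommGroup F] [Module ℂ F] [TopologicalSpace F] [AddCommGroup G] [Module ℂ G]
    [TopologicalSpace G] (b : E →ₗ[ℂ] F →ₗ[ℂ] G) : Prop :=
  (∀ x : E, Continuous fun y => b x y) ∧ ∀ y : F, Continuous fun x => b x y

/-- A set `H` of linear maps `E → F` is an equicontinuous subset of `L(E, F)`: its elements are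
continuous and for every `0`-neighborhood `V` there is a `0`-neighborhood `U` with `T(U) ⊆ V` for
all `T ∈ H`. -/
def IsEquicontinuousSet {E F : Type*} [AddCommGroup E] [Module ℂ E] [TopologicalSpace E]
    [AddCommGroup F] [Module ℂ F] [TopologicalSpace F] (H : Set (E →ₗ[ℂ] F)) : Prop :=
  (∀ T ∈ H, Continuous T) ∧ ∀ V ∈ 𝓝 (0 : F), ∃ U ∈ 𝓝 (0 : E), ∀ T ∈ H, ∀ x ∈ U, T x ∈ V

/-- Hypocontinuity of a bilinear map with respect to the bounded sets of both factors. -/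
def IsHypocontinuous {E F G : Type*} [AddCommGroup E] [Module ℂ E] [TopologicalSpace E]
    [AddCommGroup F] [Module ℂ F] [TopologicalSpace F] [AddCommGroup G] [Module ℂ G]
    [TopologicalSpace G] (b : E →ₗ[ℂ] F →ₗ[ℂ] G) : Prop :=
  (∀ A : Set E, Bornology.IsVonNBounded ℂ A → IsEquicontinuousSet {T | ∃ x ∈ A, T = b x}) ∧
  ∀ B : Set F, Bornology.IsVonNBounded ℂ B → IsEquicontinuousSet {T | ∃ y ∈ B, T = b.flip y}

end

/-!
The exponentials `exp(lam φ*(k / lam)) = sup_{u ≥ 1} u^k exp(-lam ω(u))` (`powerWeight`) replace the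
Young conjugate throughout. They are supermultiplicative in `k`, and by condition `(α)` a geometric
factor `L^k` is absorbed by enlarging `lam`. The Leibniz rule therefore gives, with `m` depending
only on `lam`,
`q_{lam,μ}(f g) ≤ C r_{m,n}(f) q_{m,μ+n}(g)` (`exists_qNorm_mul_le`).

To use this, `S_ω` has to be described by the norms `q_{lam,μ}` alone
(`memS_iff_hasFiniteQNorms`).
* If `f ∈ S_ω`, Fourier inversion and the decay of `𝓕 f` give `|∂^α f| ≤ C powerWeight lam |α|`,
  uniformly in `α` but without decay in `x`. Decay is recovered by interpolating with the decay
  of `f` itself: a half-line Landau-Kolmogorov inequality `‖g^(k)‖² ≤ D^k ‖g‖ ‖g^(2k)‖`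
  (`norm_iteratedDeriv_zero_sq_le`) is applied on rays that point away from the origin, on which
  the weight only grows. Its constant is exponential in `k`, so it is absorbed as well.
* Conversely, if all `q_{lam,μ}(f)` are finite, then `|ξ_j|^k |𝓕 f(ξ)|` is bounded by a multiple of
  `powerWeight lam k` for all `k`, and convexity of `φ` recovers `exp(-lam ω(ξ))` from these bounds
  (`exists_powerWeight_mul_exp_le`). Derivatives of `𝓕 f` reduce to this case because the
  coordinate functions are multipliers.

On the topological side, a seminorm dominated by a multiple of `r_{m,n}` for each `n` is continuous
on `O^m_ω`, hence on `O_{M,ω}` (`SpaceOM.ball_mem_nhds`). Applied to `f ↦ sup_{g ∈ B} q_{lam,μ}(f g)`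
this gives equicontinuity of `{M(·, g) : g ∈ B}`. Applied to a supremum of weighted point evaluations
of derivatives it shows that a bounded set `A ⊆ O_{M,ω}` is, for each `m`, bounded in a single norm
`r_{m,n}` (`SpaceOM.exists_rNorm_le_of_isVonNBounded`), whence the equicontinuity of
`{M(f, ·) : f ∈ A}`. Separate continuity is the case of singletons.
-/

noncomputable section

variable {N : ℕ} {ω : ℝ → ℝ}

/-! ### Conjugate weights and their exponentials -/

/-- `sup_{u ≥ 1} u^k exp(-lam ω(u)) = exp(lam φ*(k / lam))`. The value `∞` occurs, for example for
`ω t = log (1 + t)` and `k > lam`; the norms then impose no condition on derivatives of order `k`. -/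
def powerWeight (ω : ℝ → ℝ) (lam : ℝ) (k : ℕ) : ℝ≥0∞ :=
  ⨆ (u : ℝ) (_ : 1 ≤ u), ENNReal.ofReal (u ^ k * Real.exp (-lam * ω u))

theorem exp_youngConj {lam : ℝ} (hlam : 0 < lam) (k : ℕ) :
    EReal.exp ((lam : EReal) * youngConj ω (k / lam)) = powerWeight ω lam k := by
  have hexp : ∀ u : ℝ, 1 ≤ u → EReal.exp ((lam : EReal) *
      ((k / lam * Real.log u - ω (Real.exp (Real.log u)) : ℝ) : EReal)) =
      ENNReal.ofReal (u ^ k * Real.exp (-lam * ω u)) := by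
    intro u hu
    have hu0 : 0 < u := by linarith
    rw [← EReal.coe_mul, EReal.exp_coe, Real.exp_log hu0]
    congr 1
    have h1 : u ^ k = Real.exp (k * Real.log u) := by
      rw [Real.exp_nat_mul, Real.exp_log hu0]
    rw [h1, ← Real.exp_add]
    congr 1
    field_simp
    ring
  apply le_antisymm
  · obtain ⟨c, hc⟩ : ∃ c : EReal, EReal.exp c = powerWeight ω lam k :=
      ⟨ENNReal.log (powerWeight ω lam k), by simp⟩
    rw [← hc, EReal.exp_le_exp_iff, mul_comm,
      ← EReal.le_div_iff_mul_le (by exact_mod_cast hlam) (EReal.coe_ne_top _)]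
    refine iSup₂_le fun t ht => ?_
    rw [EReal.le_div_iff_mul_le (by exact_mod_cast hlam) (EReal.coe_ne_top _), mul_comm,
      ← EReal.exp_le_exp_iff, hc]
    have := hexp (Real.exp t) (Real.one_le_exp ht)
    rw [Real.log_exp] at this
    rw [this]
    exact le_iSup₂ (f := fun (u : ℝ) (_ : 1 ≤ u) =>
      ENNReal.ofReal (u ^ k * Real.exp (-lam * ω u))) (Real.exp t) (Real.one_le_exp ht)
  · refine iSup₂_le fun u hu => ?_
    rw [← hexp u hu, EReal.exp_le_exp_iff]
    refine mul_le_mul_of_nonneg_left ?_ (by exact_mod_cast hlam.le)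
    exact le_iSup₂ (f := fun (t : ℝ) (_ : 0 ≤ t) =>
      ((k / lam * t - ω (Real.exp t) : ℝ) : EReal)) (Real.log u) (Real.log_nonneg hu)

theorem exp_sub_youngConj {lam : ℝ} (hlam : 0 < lam) (k : ℕ) (c : ℝ) :
    EReal.exp ((c : EReal) - (lam : EReal) * youngConj ω (k / lam)) =
      ENNReal.ofReal (Real.exp c) / powerWeight ω lam k := by
  rw [sub_eq_add_neg, EReal.exp_add, EReal.exp_neg, exp_youngConj hlam, EReal.exp_coe,
    div_eq_mul_inv]

theorem ofReal_pow_le_powerWeight {lam u : ℝ} (hu : 1 ≤ u) (k : ℕ) :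
    ENNReal.ofReal (u ^ k) ≤ powerWeight ω lam k * ENNReal.ofReal (Real.exp (lam * ω u)) := by
  have h : u ^ k = u ^ k * Real.exp (-lam * ω u) * Real.exp (lam * ω u) := by
    rw [mul_assoc, ← Real.exp_add]; simp
  rw [h, ENNReal.ofReal_mul (by positivity)]
  gcongr
  exact le_iSup₂ (f := fun (u : ℝ) (_ : 1 ≤ u) =>
      ENNReal.ofReal (u ^ k * Real.exp (-lam * ω u))) u hu

theorem le_powerWeight (lam : ℝ) (k : ℕ) :
    ENNReal.ofReal (Real.exp (-lam * ω 1)) ≤ powerWeight ω lam k := by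
  refine le_trans (by simp) (le_iSup₂ (f := fun (u : ℝ) (_ : 1 ≤ u) =>
    ENNReal.ofReal (u ^ k * Real.exp (-lam * ω u))) 1 le_rfl)

theorem powerWeight_ne_zero (lam : ℝ) (k : ℕ) : powerWeight ω lam k ≠ 0 :=
  ((ENNReal.ofReal_pos.2 (Real.exp_pos _)).trans_le (le_powerWeight lam k)).ne'

theorem powerWeight_two_mul (lam : ℝ) (k : ℕ) :
    powerWeight ω (2 * lam) (2 * k) ≤ powerWeight ω lam k ^ 2 := by
  refine iSup₂_le fun u hu => ?_
  have h : u ^ (2 * k) * Real.exp (-(2 * lam) * ω u) = (u ^ k * Real.exp (-lam * ω u)) ^ 2 := by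
    rw [mul_pow, ← pow_mul, mul_comm 2 k, ← Real.exp_nat_mul]
    congr 2
    push_cast; ring
  rw [h, ENNReal.ofReal_pow (by positivity)]
  gcongr
  exact le_iSup₂ (f := fun (u : ℝ) (_ : 1 ≤ u) =>
      ENNReal.ofReal (u ^ k * Real.exp (-lam * ω u))) u hu

namespace IsNonQuasianalyticWeight

/-- Since `ω` is nonnegative, both factors may be evaluated at the larger of the two points. -/
theorem powerWeight_mul_le {lam : ℝ} (hω : IsNonQuasianalyticWeight ω) (hlam : 0 ≤ lam)
    (j k : ℕ) : powerWeight ω lam j * powerWeight ω lam k ≤ powerWeight ω lam (j + k) := by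
  have aux : ∀ (j k : ℕ) (u v : ℝ), 1 ≤ u → u ≤ v →
      ENNReal.ofReal (u ^ j * Real.exp (-lam * ω u)) *
        ENNReal.ofReal (v ^ k * Real.exp (-lam * ω v)) ≤ powerWeight ω lam (j + k) := by
    intro j k u v hu huv
    rw [← ENNReal.ofReal_mul (by positivity)]
    refine le_trans (ENNReal.ofReal_le_ofReal ?_) (le_iSup₂ (f := fun (u : ℝ) (_ : 1 ≤ u) =>
      ENNReal.ofReal (u ^ (j + k) * Real.exp (-lam * ω u))) v (hu.trans huv))
    have h1 : Real.exp (-lam * ω u) ≤ 1 :=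
      Real.exp_le_one_iff.2 (by nlinarith [hω.nonneg u (by linarith)])
    have h2 : u ^ j ≤ v ^ j := by gcongr
    calc u ^ j * Real.exp (-lam * ω u) * (v ^ k * Real.exp (-lam * ω v))
        ≤ v ^ j * 1 * (v ^ k * Real.exp (-lam * ω v)) := by
          have : 0 ≤ v := by linarith
          gcongr
      _ = _ := by ring
  rw [powerWeight, powerWeight]
  simp only [ENNReal.iSup_mul, ENNReal.mul_iSup]
  refine iSup₂_le fun u hu => iSup₂_le fun v hv => ?_
  rcases le_total v u with h | h
  · exact aux j k v u hv h
  · rw [mul_comm, add_comm]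
    exact aux k j u v hu h

theorem powerWeight_anti (hω : IsNonQuasianalyticWeight ω) {lam lam' : ℝ} (h : lam ≤ lam')
    (k : ℕ) : powerWeight ω lam' k ≤ powerWeight ω lam k := by
  refine iSup₂_mono fun u hu => ENNReal.ofReal_le_ofReal ?_
  have := hω.nonneg u (by linarith)
  have : 0 ≤ u := by linarith
  gcongr

/-- Geometric factors `L ^ k` are absorbed by enlarging `lam`: this is where the condition
`(α)` enters. -/
theorem exists_pow_mul_powerWeight_le (hω : IsNonQuasianalyticWeight ω) (L : ℝ) {lam : ℝ}
    (hlam : 0 < lam) : ∃ lam', lam ≤ lam' ∧ ∃ C : ℝ, 0 < C ∧ ∀ k,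
      ENNReal.ofReal (L ^ k) * powerWeight ω lam' k ≤
        ENNReal.ofReal C * powerWeight ω lam k := by
  obtain ⟨K, hK, hα⟩ := hω.alpha
  have step : ∀ lam : ℝ, 0 < lam → ∀ k, ENNReal.ofReal (2 ^ k) * powerWeight ω (K * lam) k ≤
      ENNReal.ofReal (Real.exp (lam * K)) * powerWeight ω lam k := by
    intro lam hlam k
    simp only [powerWeight, ENNReal.mul_iSup]
    refine iSup₂_le fun u hu => ?_
    refine le_trans ?_ (le_iSup₂ (f := fun (u : ℝ) (_ : 1 ≤ u) =>
      ENNReal.ofReal (Real.exp (lam * K)) *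
      ENNReal.ofReal (u ^ k * Real.exp (-lam * ω u))) (2 * u) (by linarith))
    rw [← ENNReal.ofReal_mul (by positivity), ← ENNReal.ofReal_mul (by positivity)]
    apply ENNReal.ofReal_le_ofReal
    have h1 := hα u (by linarith)
    have h2 : Real.exp (-(K * lam) * ω u) ≤
        Real.exp (lam * K) * Real.exp (-lam * ω (2 * u)) := by
      rw [← Real.exp_add]
      apply Real.exp_le_exp.2
      nlinarith
    have : 0 ≤ u := by linarith
    calc 2 ^ k * (u ^ k * Real.exp (-(K * lam) * ω u))
        ≤ 2 ^ k * (u ^ k * (Real.exp (lam * K) * Real.exp (-lam * ω (2 * u)))) := by gcongr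
      _ = _ := by rw [mul_pow]; ring
  -- Each application of `(α)` gains a factor `2 ^ k`, so iterating it exceeds any `L ^ k`.
  have main : ∀ p : ℕ, ∃ lam', lam ≤ lam' ∧ ∃ C : ℝ, 0 < C ∧ ∀ k,
      ENNReal.ofReal ((2 ^ p) ^ k) * powerWeight ω lam' k ≤
        ENNReal.ofReal C * powerWeight ω lam k := by
    intro p
    induction p with
    | zero => exact ⟨lam, le_rfl, 1, one_pos, fun k => by simp⟩
    | succ p ih =>
      obtain ⟨lam', hl, C, hC, h⟩ := ih
      have hl' : 0 < lam' := by linarith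
      refine ⟨K * lam', by nlinarith, Real.exp (lam' * K) * C, by positivity, fun k => ?_⟩
      rw [pow_succ, mul_pow, ENNReal.ofReal_mul (by positivity),
        ENNReal.ofReal_mul (by positivity), mul_assoc]
      calc _ ≤ ENNReal.ofReal ((2 ^ p) ^ k) *
            (ENNReal.ofReal (Real.exp (lam' * K)) * powerWeight ω lam' k) := by
            exact mul_le_mul_right (step lam' hl' k) _
        _ = ENNReal.ofReal (Real.exp (lam' * K)) *
            (ENNReal.ofReal ((2 ^ p) ^ k) * powerWeight ω lam' k) := by ring
        _ ≤ _ := by rw [mul_assoc]; exact mul_le_mul_right (h k) _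
  obtain ⟨p, hp⟩ := pow_unbounded_of_one_lt |L| (one_lt_two : (1 : ℝ) < 2)
  obtain ⟨lam', hl, C, hC, h⟩ := main p
  refine ⟨lam', hl, C, hC, fun k => le_trans ?_ (h k)⟩
  refine mul_le_mul_left (ENNReal.ofReal_le_ofReal ?_) _
  calc L ^ k ≤ |L ^ k| := le_abs_self _
    _ = |L| ^ k := abs_pow _ _
    _ ≤ _ := by gcongr

theorem ofReal_pow_le_of_nonneg (hω : IsNonQuasianalyticWeight ω) {lam u : ℝ} (hlam : 0 ≤ lam)
    (hu : 0 ≤ u) (k : ℕ) : ENNReal.ofReal (u ^ k) ≤ ENNReal.ofReal (Real.exp (lam * ω 1)) *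
      powerWeight ω lam k * ENNReal.ofReal (Real.exp (lam * ω u)) := by
  have h1 := hω.nonneg 1 zero_le_one
  have h2 := hω.nonneg u hu
  have one_le : ∀ c : ℝ, 0 ≤ c → 1 ≤ ENNReal.ofReal (Real.exp c) := fun c hc => by
    rw [← ENNReal.ofReal_one]; exact ENNReal.ofReal_le_ofReal (Real.one_le_exp hc)
  rcases le_total 1 u with h | h
  · calc _ ≤ 1 * (powerWeight ω lam k * ENNReal.ofReal (Real.exp (lam * ω u))) := by
          rw [one_mul]; exact ofReal_pow_le_powerWeight h k
      _ ≤ _ := by rw [mul_assoc]; gcongr; exact one_le _ (by positivity)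
  · calc ENNReal.ofReal (u ^ k) ≤ 1 * 1 := by
          rw [one_mul, ← ENNReal.ofReal_one]
          exact ENNReal.ofReal_le_ofReal (pow_le_one₀ hu h)
      _ ≤ (ENNReal.ofReal (Real.exp (lam * ω 1)) * powerWeight ω lam k) *
          ENNReal.ofReal (Real.exp (lam * ω u)) := by
        gcongr
        · calc 1 = ENNReal.ofReal (Real.exp (lam * ω 1)) *
                ENNReal.ofReal (Real.exp (-lam * ω 1)) := by
                rw [← ENNReal.ofReal_mul (by positivity), ← Real.exp_add]; simp
            _ ≤ _ := by gcongr; exact le_powerWeight lam k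
        · exact one_le _ (by positivity)

/-- Condition `(γ)`: powers of `1 + t` are dominated by exponentials of `ω`. -/
theorem exists_pow_le_exp (hω : IsNonQuasianalyticWeight ω) (k : ℕ) :
    ∃ μ C : ℝ, 0 < μ ∧ 0 < C ∧ ∀ t, 0 ≤ t → (1 + t) ^ k ≤ C * Real.exp (μ * ω t) := by
  obtain ⟨a, b, hb, h⟩ := hω.gamma
  refine ⟨(k + 1) / b, Real.exp (-((k + 1) / b * a)), by positivity, by positivity,
    fun t ht => ?_⟩
  have h1 : (1 + t) ^ k = Real.exp (k * Real.log (1 + t)) := by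
    rw [Real.exp_nat_mul, Real.exp_log (by linarith)]
  rw [h1, ← Real.exp_add, Real.exp_le_exp]
  have h2 := mul_le_mul_of_nonneg_left (h t ht) (show 0 ≤ (k + 1) / b by positivity)
  have h3 : (k + 1) / b * (a + b * Real.log (1 + t)) =
      (k + 1) / b * a + (k + 1) * Real.log (1 + t) := by field_simp
  have h4 : 0 ≤ Real.log (1 + t) := Real.log_nonneg (by linarith)
  nlinarith

theorem exists_powerWeight_ne_top (hω : IsNonQuasianalyticWeight ω) (k : ℕ) :
    ∃ lam, 0 < lam ∧ powerWeight ω lam k ≠ ∞ := by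
  obtain ⟨μ, C, hμ, hC, h⟩ := hω.exists_pow_le_exp k
  refine ⟨μ, hμ, ((iSup₂_le fun u hu => ?_).trans_lt (ENNReal.ofReal_lt_top (r := C))).ne⟩
  apply ENNReal.ofReal_le_ofReal
  have h1 := h u (by linarith)
  have h2 : u ^ k ≤ (1 + u) ^ k := by gcongr; linarith
  calc u ^ k * Real.exp (-μ * ω u) ≤ C * Real.exp (μ * ω u) * Real.exp (-μ * ω u) := by
        gcongr; linarith
    _ = C := by rw [mul_assoc, ← Real.exp_add]; simp

/-- The biconjugate of the convex function `φ = ω ∘ exp` is `φ` itself; restricting the slopes to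
integers costs one factor `v`. -/
theorem exists_powerWeight_mul_exp_le (hω : IsNonQuasianalyticWeight ω) {lam v : ℝ}
    (hlam : 0 < lam) (hv : 1 ≤ v) : ∃ k : ℕ,
      powerWeight ω lam k * ENNReal.ofReal (Real.exp (lam * ω v)) ≤
        ENNReal.ofReal (v ^ (k + 1)) := by
  have hv0 : 0 < v := by linarith
  set φ : ℝ → ℝ := fun t => ω (Real.exp t) with hφ
  set t := Real.log v with ht
  have ht0 : 0 ≤ t := Real.log_nonneg hv
  have hmono : ∀ r s, r ≤ s → φ r ≤ φ s := fun r s hrs =>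
    hω.monotoneOn (Real.exp_pos r).le (Real.exp_pos s).le (Real.exp_le_exp.2 hrs)
  -- A supporting line of `φ` at `t`; the right derivative serves as its slope.
  obtain ⟨s, hs⟩ : ∃ s : ℝ, ∀ r, φ t + s * (r - t) ≤ φ r := by
    have hc := hω.delta
    have hi : ∀ x : ℝ, x ∈ interior (univ : Set ℝ) := by simp
    refine ⟨derivWithin φ (Ioi t) t, fun r => ?_⟩
    rcases lt_trichotomy r t with h | h | h
    · have h1 := hc.slope_le_leftDeriv_of_mem_interior (mem_univ r) (hi t) h
      have h2 := h1.trans (hc.leftDeriv_le_rightDeriv_of_mem_interior (hi t))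
      rw [slope_def_field, div_le_iff₀ (by linarith)] at h2
      change φ t - φ r ≤ derivWithin φ (Ioi t) t * (t - r) at h2
      linarith
    · simp [h]
    · have h1 := hc.rightDeriv_le_slope_of_mem_interior (hi t) (mem_univ r) h
      rw [slope_def_field, le_div_iff₀ (by linarith)] at h1
      change derivWithin φ (Ioi t) t * (r - t) ≤ φ r - φ t at h1
      linarith
  have hs0 : 0 ≤ s := by
    have h1 := hs (t - 1)
    have h2 := hmono (t - 1) t (by linarith)
    linarith
  -- The supremum defining `powerWeight ω lam k` would be attained at `v` for the order `lam * s`.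
  refine ⟨⌊lam * s⌋₊, ?_⟩
  set k := ⌊lam * s⌋₊
  have hk1 : (k : ℝ) ≤ lam * s := Nat.floor_le (by positivity)
  have hk2 : lam * s < k + 1 := Nat.lt_floor_add_one _
  simp only [powerWeight, ENNReal.iSup_mul]
  refine iSup₂_le fun u hu => ?_
  rw [← ENNReal.ofReal_mul (by have : 0 ≤ u := by linarith
                               positivity)]
  apply ENNReal.ofReal_le_ofReal
  have hu0 : 0 < u := by linarith
  have e1 : u ^ k = Real.exp (k * Real.log u) := by rw [Real.exp_nat_mul, Real.exp_log hu0]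
  have e2 : v ^ (k + 1) = Real.exp ((k + 1) * t) := by
    rw [show ((k : ℝ) + 1) = ((k + 1 : ℕ) : ℝ) by push_cast; ring, Real.exp_nat_mul,
      Real.exp_log hv0]
  have e3 : ω u = φ (Real.log u) := by simp [hφ, Real.exp_log hu0]
  have e4 : ω v = φ t := by simp [hφ, ht, Real.exp_log hv0]
  rw [e1, e2, e3, e4, ← Real.exp_add, ← Real.exp_add, Real.exp_le_exp]
  have h1 := mul_le_mul_of_nonneg_left (hs (Real.log u)) hlam.le
  have h2 := mul_le_mul_of_nonneg_right hk1 (Real.log_nonneg hu)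
  have h3 := mul_le_mul_of_nonneg_right hk2.le ht0
  nlinarith

end IsNonQuasianalyticWeight

theorem weightedSup_eq (ω : ℝ → ℝ) {lam : ℝ} (hlam : 0 < lam) (μ : ℝ) (f : RN N → ℂ) :
    weightedSup ω lam μ f = ⨆ (α : Fin N → ℕ) (x : RN N), ‖mderiv α f x‖ₑ *
      ENNReal.ofReal (Real.exp (μ * ω ‖x‖)) / powerWeight ω lam (∑ i, α i) := by
  simp only [weightedSup, exp_sub_youngConj hlam, mul_div_assoc]

theorem weightedSup_le {lam : ℝ} (hlam : 0 < lam) {μ : ℝ} {f : RN N → ℂ}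
    {C : ℝ≥0∞} (h : ∀ α, powerWeight ω lam (∑ i, α i) ≠ ∞ → ∀ x, ‖mderiv α f x‖ₑ * ENNReal.ofReal (Real.exp (μ * ω ‖x‖)) ≤
      C * powerWeight ω lam (∑ i, α i)) : weightedSup ω lam μ f ≤ C := by
  rw [weightedSup_eq ω hlam]
  refine iSup₂_le fun α x => ?_
  by_cases hα : powerWeight ω lam (∑ i, α i) = ∞
  · simp [hα]
  · exact ENNReal.div_le_of_le_mul (h α hα x)

theorem enorm_mderiv_mul_le {lam : ℝ} (hlam : 0 < lam) {μ : ℝ}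
    {f : RN N → ℂ} (α : Fin N → ℕ) (hα : powerWeight ω lam (∑ i, α i) ≠ ∞) (x : RN N) :
    ‖mderiv α f x‖ₑ * ENNReal.ofReal (Real.exp (μ * ω ‖x‖)) ≤
      weightedSup ω lam μ f * powerWeight ω lam (∑ i, α i) := by
  rw [← ENNReal.div_le_iff (powerWeight_ne_zero _ _) hα,
    weightedSup_eq ω hlam]
  exact le_iSup₂ (f := fun (α : Fin N → ℕ) (x : RN N) => ‖mderiv α f x‖ₑ *
      ENNReal.ofReal (Real.exp (μ * ω ‖x‖)) / powerWeight ω lam (∑ i, α i)) α x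

/-! ### Partial derivatives and the Leibniz estimate -/

theorem multiIndex_induction {P : (Fin N → ℕ) → Prop} (zero : P 0)
    (add_single : ∀ α i, P α → P (α + Pi.single i 1)) (α : Fin N → ℕ) : P α := by
  induction h : ∑ i, α i generalizing α with
  | zero =>
    have : α = 0 := by
      funext i
      exact (Finset.sum_eq_zero_iff.1 h) i (Finset.mem_univ i)
    exact this ▸ zero
  | succ n ih =>
    obtain ⟨i, hi⟩ : ∃ i, α i ≠ 0 := by
      by_contra! hc
      simp [hc] at h
    obtain ⟨β, rfl⟩ : ∃ β : Fin N → ℕ, α = β + Pi.single i 1 := by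
      refine ⟨α - Pi.single i 1, funext fun j => ?_⟩
      by_cases hj : j = i
      · subst hj; simp; omega
      · simp [hj]
    refine add_single β i (ih β ?_)
    simpa [Finset.sum_add_distrib] using h

theorem sum_add_single (α : Fin N → ℕ) (i : Fin N) (k : ℕ) :
    ∑ j, (α + Pi.single i k : Fin N → ℕ) j = ∑ j, α j + k := by
  simp [Finset.sum_add_distrib]

theorem pderivRN_comm (i j : Fin N) {f : RN N → ℂ} (hf : IsSmooth f) :
    pderivRN i (pderivRN j f) = pderivRN j (pderivRN i f) := by
  have hd : Differentiable ℝ (fderiv ℝ f) :=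
    (hf.fderiv_right (m := ((⊤ : ℕ∞) : WithTop ℕ∞)) (by simp)).differentiable (by simp)
  have key : ∀ (i j : Fin N) (x : RN N), pderivRN i (pderivRN j f) x =
      fderiv ℝ (fderiv ℝ f) x (EuclideanSpace.single i 1) (EuclideanSpace.single j 1) := by
    intro i j x
    change fderiv ℝ (fun y => fderiv ℝ f y (EuclideanSpace.single j 1)) x _ = _
    rw [fderiv_clm_apply (hd x) (differentiableAt_const _)]
    simp
  funext x
  rw [key, key]
  exact (hf.contDiffAt.isSymmSndFDerivAt (by simp; exact WithTop.coe_le_coe.2 (le_top : (2 : ℕ∞) ≤ ⊤))).eq _ _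

theorem isSmooth_mderiv (α : Fin N → ℕ) {f : RN N → ℂ} (hf : IsSmooth f) :
    IsSmooth (mderiv α f) := (mderiv_aux α _ 0 hf hf).1

theorem isSmooth_iterate_pderivRN (i : Fin N) (k : ℕ) {f : RN N → ℂ} (hf : IsSmooth f) :
    IsSmooth ((pderivRN i)^[k] f) := (iter_pderivRN i k 0 hf hf).1

theorem iterate_pderivRN_comm (i j : Fin N) (k : ℕ) {f : RN N → ℂ} (hf : IsSmooth f) :
    (pderivRN i)^[k] (pderivRN j f) = pderivRN j ((pderivRN i)^[k] f) := by
  induction k with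
  | zero => rfl
  | succ k ih =>
    rw [Function.iterate_succ_apply', ih, Function.iterate_succ_apply',
      pderivRN_comm i j (isSmooth_iterate_pderivRN i k hf)]

theorem mderiv_pderivRN (α : Fin N → ℕ) (i : Fin N) {f : RN N → ℂ} (hf : IsSmooth f) :
    mderiv α (pderivRN i f) = pderivRN i (mderiv α f) := by
  unfold mderiv
  induction List.finRange N with
  | nil => rfl
  | cons j l ih =>
    rw [List.foldr_cons, ih, List.foldr_cons,
      iterate_pderivRN_comm _ _ _ (mderiv_aux α l 0 hf hf).1]

theorem mderiv_add_single (α : Fin N → ℕ) (i : Fin N) {f : RN N → ℂ} (hf : IsSmooth f) :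
    mderiv (α + Pi.single i 1) f = pderivRN i (mderiv α f) := by
  have notMem : ∀ l : List (Fin N), i ∉ l →
      l.foldr (fun j g => (pderivRN j)^[(α + Pi.single i 1 : Fin N → ℕ) j] g) f =
        l.foldr (fun j g => (pderivRN j)^[α j] g) f := by
    intro l hl
    induction l with
    | nil => rfl
    | cons j l ih =>
      have hj : j ≠ i := fun h => hl (by simp [h])
      rw [List.foldr_cons, List.foldr_cons, ih (fun h => hl (by simp [h]))]
      simp [hj]
  have mem : ∀ l : List (Fin N), l.Nodup → i ∈ l →
      l.foldr (fun j g => (pderivRN j)^[(α + Pi.single i 1 : Fin N → ℕ) j] g) f =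
        pderivRN i (l.foldr (fun j g => (pderivRN j)^[α j] g) f) := by
    intro l hn hl
    induction l with
    | nil => simp at hl
    | cons j l ih =>
      rw [List.foldr_cons, List.foldr_cons]
      rw [List.nodup_cons] at hn
      by_cases hj : j = i
      · subst hj
        rw [notMem l hn.1, ← Function.iterate_succ_apply' (pderivRN j)]
        simp
      · rw [ih hn.2 (by simpa [Ne.symm hj] using hl),
          iterate_pderivRN_comm _ _ _ (mderiv_aux α l 0 hf hf).1]
        simp [hj]
  exact mem _ (List.nodup_finRange N) (List.mem_finRange i)

theorem mderiv_zero_index (f : RN N → ℂ) : mderiv 0 f = f := by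
  unfold mderiv
  induction List.finRange N with
  | nil => rfl
  | cons j l ih => rw [List.foldr_cons, ih]; rfl

theorem mderiv_add_single_nat (α : Fin N → ℕ) (i : Fin N) (k : ℕ) {f : RN N → ℂ}
    (hf : IsSmooth f) : mderiv (α + Pi.single i k) f = (pderivRN i)^[k] (mderiv α f) := by
  induction k with
  | zero => simp
  | succ k ih =>
    rw [Function.iterate_succ_apply', ← ih, ← mderiv_add_single _ _ hf, add_assoc,
      ← Pi.single_add]

theorem pderivRN_mul (i : Fin N) {f g : RN N → ℂ} (hf : IsSmooth f) (hg : IsSmooth g) :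
    pderivRN i (f * g) = pderivRN i f * g + f * pderivRN i g := by
  funext x
  simp only [pderivRN, Pi.add_apply, Pi.mul_apply]
  rw [fderiv_mul (hf.differentiable (by simp) x) (hg.differentiable (by simp) x)]
  simp
  ring

/-- The Leibniz rule as an estimate: the binomial coefficients add up to `2 ^ |α|`. -/
theorem enorm_mderiv_mul_le_of_forall (α : Fin N → ℕ) {f g : RN N → ℂ} (hf : IsSmooth f)
    (hg : IsSmooth g) (x : RN N) {B : ℝ≥0∞}
    (h : ∀ β γ, β + γ = α → ‖mderiv β f x‖ₑ * ‖mderiv γ g x‖ₑ ≤ B) :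
    ‖mderiv α (f * g) x‖ₑ ≤ 2 ^ (∑ i, α i) * B := by
  induction α using multiIndex_induction generalizing f g with
  | zero =>
    have := h 0 0 (by simp)
    simpa [mderiv_zero_index] using this
  | add_single α i ih =>
    have hfi := contDiff_pderivRN i hf
    have hgi := contDiff_pderivRN i hg
    have hfg : IsSmooth (f * g) := hf.mul hg
    have h1 : IsSmooth (pderivRN i f * g) := hfi.mul hg
    have h2 : IsSmooth (f * pderivRN i g) := hf.mul hgi
    have e : mderiv (α + Pi.single i 1) (f * g) =
        mderiv α (pderivRN i f * g) + mderiv α (f * pderivRN i g) := by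
      rw [mderiv_add_single _ _ hfg, ← mderiv_pderivRN _ _ hfg,
        pderivRN_mul i hf hg, mderiv_add _ h1 h2]
    have h1 := ih hfi hg fun β γ hβγ => by
      rw [mderiv_pderivRN _ _ hf, ← mderiv_add_single _ _ hf]
      exact h _ _ (by rw [← hβγ]; abel)
    have h2 := ih hf hgi fun β γ hβγ => by
      rw [mderiv_pderivRN _ _ hg, ← mderiv_add_single _ _ hg]
      exact h _ _ (by rw [← hβγ]; abel)
    rw [e, sum_add_single, pow_succ, Pi.add_apply]
    calc _ ≤ _ := enorm_add_le _ _
      _ ≤ 2 ^ (∑ i, α i) * B + 2 ^ (∑ i, α i) * B := add_le_add h1 h2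
      _ = _ := by ring

/-- Multiplication `O^m_{n,ω} × S_ω → S_ω`, at the level of the norms. The index `m` depends only
on `lam`, not on `n` and `μ`. -/
theorem exists_weightedSup_mul_le (hω : IsNonQuasianalyticWeight ω) {lam : ℝ}
    (hlam : 0 < lam) : ∃ m₀ : ℝ, ∃ C : ℝ≥0∞, C ≠ ∞ ∧ ∀ m ≥ m₀, 0 < m → ∀ (μ ν : ℝ)
      (f g : RN N → ℂ), IsSmooth f → IsSmooth g → weightedSup ω lam (μ + ν) (f * g) ≤
        C * (weightedSup ω m μ f * weightedSup ω m ν g) := by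
  obtain ⟨m₀, hm₀, C, hC, h⟩ := hω.exists_pow_mul_powerWeight_le 2 hlam
  refine ⟨m₀, ENNReal.ofReal C, ENNReal.ofReal_ne_top, fun m hm hm0 μ ν f g hf hg => ?_⟩
  refine weightedSup_le hlam fun α hα x => ?_
  set R := weightedSup ω m μ f
  set Q := weightedSup ω m ν g
  set E := fun μ : ℝ => ENNReal.ofReal (Real.exp (μ * ω ‖x‖)) with hE'
  have hE : E (μ + ν) = E μ * E ν := by
    simp only [E]
    rw [← ENNReal.ofReal_mul (by positivity), ← Real.exp_add, add_mul]
  have hEne : E (μ + ν) ≠ ∞ := ENNReal.ofReal_ne_top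
  have hE0 : E (μ + ν) ≠ 0 := by simp [E, Real.exp_pos]
  have hαm : powerWeight ω m (∑ i, α i) ≠ ∞ :=
    ((hω.powerWeight_anti (by linarith) _).trans_lt hα.lt_top).ne
  have key := enorm_mderiv_mul_le_of_forall α hf hg x
    (B := R * Q * powerWeight ω m (∑ i, α i) / E (μ + ν)) fun β γ hβγ => by
    have hsum : ∑ i, β i + ∑ i, γ i = ∑ i, α i := by
      rw [← hβγ]; simp [Finset.sum_add_distrib]
    have hW := hω.powerWeight_mul_le hm0.le (∑ i, β i) (∑ i, γ i)
    rw [hsum] at hW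
    have hW' := (hW.trans_lt hαm.lt_top).ne
    have hβ := (ENNReal.lt_top_of_mul_ne_top_left hW'
      (powerWeight_ne_zero _ _)).ne
    have hγ := (ENNReal.lt_top_of_mul_ne_top_right hW'
      (powerWeight_ne_zero _ _)).ne
    rw [ENNReal.le_div_iff_mul_le (Or.inl hE0) (Or.inl hEne), hE]
    calc _ = (‖mderiv β f x‖ₑ * E μ) * (‖mderiv γ g x‖ₑ * E ν) := by ring
      _ ≤ (R * powerWeight ω m (∑ i, β i)) * (Q * powerWeight ω m (∑ i, γ i)) :=
          mul_le_mul' (enorm_mderiv_mul_le hm0 β hβ x) (enorm_mderiv_mul_le hm0 γ hγ x)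
      _ = R * Q * (powerWeight ω m (∑ i, β i) * powerWeight ω m (∑ i, γ i)) := by ring
      _ ≤ _ := mul_le_mul_right hW _
  calc _ ≤ 2 ^ (∑ i, α i) * (R * Q * powerWeight ω m (∑ i, α i) / E (μ + ν)) * E (μ + ν) :=
        mul_le_mul_left key _
    _ = R * Q * (2 ^ (∑ i, α i) * powerWeight ω m (∑ i, α i)) := by
        rw [mul_assoc, ENNReal.div_mul_cancel hE0 hEne]; ring
    _ ≤ R * Q * (ENNReal.ofReal C * powerWeight ω lam (∑ i, α i)) := by
        refine mul_le_mul_right (le_trans ?_ (h (∑ i, α i))) _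
        refine mul_le_mul' ?_ (hω.powerWeight_anti hm _)
        rw [ENNReal.ofReal_pow (by norm_num)]; simp
    _ = _ := by ring

/-! ### A Landau-Kolmogorov inequality on the half-line -/

open Polynomial in
theorem abs_coeff_prod_X_sub_C_le {ι : Type*} (s : Finset ι) (v : ι → ℝ) (k : ℕ) :
    |(∏ j ∈ s, (X - C (v j))).coeff k| ≤ ∏ j ∈ s, (1 + |v j|) := by
  classical
  induction s using Finset.induction_on generalizing k with
  | empty =>
    simp only [Finset.prod_empty, coeff_one]
    split_ifs <;> simp
  | insert a s ha ih =>
    rw [Finset.prod_insert ha, Finset.prod_insert ha, sub_mul, coeff_sub, coeff_C_mul]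
    have h1 : |(X * ∏ j ∈ s, (X - C (v j))).coeff k| ≤ ∏ j ∈ s, (1 + |v j|) := by
      cases k with
      | zero => simpa using Finset.prod_nonneg fun j _ => by positivity
      | succ k => rw [coeff_X_mul]; exact ih k
    calc _ ≤ _ := abs_sub _ _
      _ ≤ ∏ j ∈ s, (1 + |v j|) + |v a| * ∏ j ∈ s, (1 + |v j|) := by
        rw [abs_mul]
        exact add_le_add h1 (mul_le_mul_of_nonneg_left (ih k) (abs_nonneg _))
      _ = _ := by ring

theorem prod_abs_sub_erase_range {n i : ℕ} (hi : i < n) :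
    ∏ j ∈ (Finset.range n).erase i, |(i : ℝ) - j| = i.factorial * (n - 1 - i).factorial := by
  induction n with
  | zero => omega
  | succ n ih =>
    rcases Nat.lt_succ_iff_lt_or_eq.1 hi with h | rfl
    · have e : (Finset.range (n + 1)).erase i = insert n ((Finset.range n).erase i) := by
        ext j; simp; omega
      rw [e, Finset.prod_insert (by simp), ih h]
      obtain ⟨d, rfl⟩ : ∃ d, n = i + 1 + d := ⟨n - i - 1, by omega⟩
      have h1 : |(i : ℝ) - (i + 1 + d : ℕ)| = d + 1 := by
        rw [abs_sub_comm, abs_of_nonneg] <;> push_cast <;> [ring; linarith]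
      have h2 : i + 1 + d - 1 - i = d := by omega
      have h3 : i + 1 + d + 1 - 1 - i = d + 1 := by omega
      rw [h1, h2, h3, Nat.factorial_succ]
      push_cast; ring
    · have e : (Finset.range (i + 1)).erase i = Finset.range i := by
        ext j; simp; omega
      rw [e]
      simp only [add_tsub_cancel_right, tsub_self, Nat.factorial_zero, Nat.cast_one, mul_one]
      rw [← Finset.prod_range_reflect, ← Finset.prod_range_add_one_eq_factorial]
      push_cast
      refine Finset.prod_congr rfl fun j hj => ?_
      have hj' : j + 1 ≤ i := Finset.mem_range.1 hj
      rw [Nat.sub_sub, add_comm 1 j, Nat.cast_sub hj', abs_of_nonneg] <;> push_cast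
      · ring
      · linarith [show (0 : ℝ) ≤ j from Nat.cast_nonneg j]

open Polynomial in
/-- The `k`-th coefficient of a polynomial of degree `< n` is a combination of its values at the
points `i / n`, with exponentially bounded coefficients. -/
theorem exists_coeff_quadrature {n k : ℕ} (hk : k < n) : ∃ c : ℕ → ℝ,
    (∀ j < n, ∑ i ∈ Finset.range n, c i * ((i : ℝ) / n) ^ j = if j = k then 1 else 0) ∧
      ∑ i ∈ Finset.range n, |c i| ≤ 12 ^ n := by
  have hn : (0 : ℝ) < n := by exact_mod_cast (by omega : 0 < n)
  set v : ℕ → ℝ := fun i => (i : ℝ) / n with hv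
  have hinj : Set.InjOn v (Finset.range n) := fun a _ b _ h => by
    simp only [hv] at h
    field_simp at h
    exact_mod_cast h
  -- The weights are the `k`-th coefficients of the Lagrange basis polynomials at the nodes `i / n`.
  refine ⟨fun i => (∏ j ∈ (Finset.range n).erase i, (X - C (v j))).coeff k /
    ∏ j ∈ (Finset.range n).erase i, (v i - v j), fun j hj => ?_, ?_⟩
  · have h := Lagrange.eq_interpolate (f := (X ^ j : ℝ[X])) hinj
      (by rw [degree_X_pow, Finset.card_range]; exact_mod_cast hj)
    have h2 := congrArg (fun p => p.coeff k) h
    simp only [Lagrange.interpolate_eq_sum, finsetSum_coeff, coeff_C_mul, coeff_X_pow,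
      eval_pow, eval_X] at h2
    rw [eq_comm] at h2
    simp only [eq_comm (a := j)]
    rw [← h2]
    refine Finset.sum_congr rfl fun i _ => ?_
    simp only [hv]
    ring
  · have bound : ∀ i ∈ Finset.range n, |(∏ j ∈ (Finset.range n).erase i,
        (X - C (v j))).coeff k / ∏ j ∈ (Finset.range n).erase i, (v i - v j)| ≤
        2 ^ (n - 1) * (n ^ n / n.factorial) * (n - 1).choose i := by
      intro i hi
      have hi' : i < n := Finset.mem_range.1 hi
      have hcard : ((Finset.range n).erase i).card = n - 1 := by
        rw [Finset.card_erase_of_mem hi, Finset.card_range]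
      have hnum : |(∏ j ∈ (Finset.range n).erase i, (X - C (v j))).coeff k| ≤ 2 ^ (n - 1) := by
        refine (abs_coeff_prod_X_sub_C_le _ _ _).trans ?_
        rw [← hcard]
        rw [← Finset.prod_const]
        refine Finset.prod_le_prod (fun j _ => by positivity) fun j hj => ?_
        have hj' : j < n := Finset.mem_range.1 (Finset.mem_of_mem_erase hj)
        have : |v j| ≤ 1 := by
          simp only [hv]
          rw [abs_of_nonneg (by positivity), div_le_one hn]
          exact_mod_cast hj'.le
        linarith
      have hden : |∏ j ∈ (Finset.range n).erase i, (v i - v j)| =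
          i.factorial * (n - 1 - i).factorial / n ^ (n - 1) := by
        rw [Finset.abs_prod, ← prod_abs_sub_erase_range hi', ← hcard, ← Finset.prod_const,
          ← Finset.prod_div_distrib]
        refine Finset.prod_congr rfl fun j _ => ?_
        simp only [hv]
        rw [← sub_div, abs_div, abs_of_pos hn]
      rw [abs_div, hden, div_div_eq_mul_div]
      rw [Nat.cast_choose ℝ (by omega : i ≤ n - 1)]
      have hfac : (n : ℝ) ^ n / n.factorial = n ^ (n - 1) / (n - 1).factorial := by
        obtain ⟨d, rfl⟩ : ∃ d, n = d + 1 := ⟨n - 1, by omega⟩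
        rw [Nat.factorial_succ, add_tsub_cancel_right, pow_succ]
        push_cast
        have : ((d : ℝ) + 1) ≠ 0 := by positivity
        field_simp
      rw [hfac]
      calc _ ≤ 2 ^ (n - 1) * (n : ℝ) ^ (n - 1) / (i.factorial * (n - 1 - i).factorial) := by
            gcongr
        _ = _ := by
          have h1 : ((n - 1).factorial : ℝ) ≠ 0 := by positivity
          field_simp
    refine (Finset.sum_le_sum bound).trans ?_
    rw [← Finset.mul_sum]
    have hs : ∑ i ∈ Finset.range n, ((n - 1).choose i : ℝ) = 2 ^ (n - 1) := by
      have := Nat.sum_range_choose (n - 1)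
      rw [Nat.sub_add_cancel (by omega)] at this
      exact_mod_cast this
    have he : (n : ℝ) ^ n / n.factorial ≤ 3 ^ n := by
      refine (Real.pow_div_factorial_le_exp n (by positivity) n).trans ?_
      rw [← mul_one (n : ℝ), Real.exp_nat_mul]
      gcongr
      linarith [Real.exp_one_lt_d9]
    rw [hs]
    calc _ ≤ (2 : ℝ) ^ n * 3 ^ n * 2 ^ n := by
          gcongr <;> norm_num
      _ = 12 ^ n := by rw [← mul_pow, ← mul_pow]; norm_num

/-- Landau-Kolmogorov inequality on a half-line, with a constant that is exponential in `k`. -/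
theorem norm_iteratedDeriv_zero_sq_le {g : ℝ → ℂ} (hg : ContDiff ℝ ((⊤ : ℕ∞) : WithTop ℕ∞) g)
    {k : ℕ} (hk : 0 < k) {A B : ℝ} (hA : 0 < A) (hB : 0 < B) (hgA : ∀ t, 0 ≤ t → ‖g t‖ ≤ A)
    (hgB : ∀ t, 0 ≤ t → ‖iteratedDeriv (2 * k) g t‖ ≤ B) :
    ‖iteratedDeriv k g 0‖ ^ 2 ≤ (4 * 2 * 12 ^ 4) ^ k * A * B := by
  obtain ⟨n, hn⟩ : ∃ n, 2 * k = n + 1 := ⟨2 * k - 1, by omega⟩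
  obtain ⟨c, hc, hcs⟩ := exists_coeff_quadrature (n := 2 * k) (k := k) (by omega)
  -- Applied to the Taylor polynomial of `g` of degree `2 * k - 1` on `[0, h]`, the quadrature formula
  -- isolates its `k`-th coefficient.
  have main : ∀ h : ℝ, 0 < h → h ^ k * ‖iteratedDeriv k g 0‖ ≤
      k.factorial * (12 ^ (2 * k) * (A + B * h ^ (2 * k) / n.factorial)) := by
    intro h hh
    set x : ℕ → ℝ := fun i => h * ((i : ℝ) / (2 * k : ℕ)) with hx
    have hx0 : ∀ i, 0 ≤ x i := fun i => by positivity
    have hxh : ∀ i ∈ Finset.range (2 * k), x i ≤ h := by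
      intro i hi
      have : (i : ℝ) / (2 * k : ℕ) ≤ 1 := by
        apply div_le_one_of_le₀ _ (by positivity)
        exact_mod_cast (Finset.mem_range.1 hi).le
      simp only [hx]
      nlinarith
    have hu : UniqueDiffOn ℝ (Icc 0 h) := uniqueDiffOn_Icc hh
    have hid : ∀ j, ∀ y ∈ Icc 0 h, iteratedDerivWithin j g (Icc 0 h) y = iteratedDeriv j g y :=
      fun j y hy => iteratedDerivWithin_eq_iteratedDeriv hu
        (hg.contDiffAt.of_le (by exact_mod_cast le_top)) hy
    have hT : ∀ i ∈ Finset.range (2 * k),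
        ‖g (x i) - taylorWithinEval g n (Icc 0 h) 0 (x i)‖ ≤ B * h ^ (2 * k) / n.factorial := by
      intro i hi
      refine (taylor_mean_remainder_bound (C := B) hh.le
        ((hg.of_le (by exact_mod_cast le_top)).contDiffOn) ⟨hx0 i, hxh i hi⟩ ?_).trans ?_
      · intro y hy
        rw [hid _ y hy, ← hn]
        exact hgB y hy.1
      · rw [sub_zero, ← hn]
        gcongr
        exact hxh i hi
    have hsum : ∑ i ∈ Finset.range (2 * k), c i • taylorWithinEval g n (Icc 0 h) 0 (x i) =
        ((k.factorial : ℝ)⁻¹ * h ^ k) • iteratedDeriv k g 0 := by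
      simp only [taylor_within_apply, sub_zero, Finset.smul_sum, smul_smul]
      rw [Finset.sum_comm, ← hn]
      have : ∀ j ∈ Finset.range (2 * k), ∑ i ∈ Finset.range (2 * k),
          (c i * ((j.factorial : ℝ)⁻¹ * x i ^ j)) • iteratedDerivWithin j g (Icc 0 h) 0 =
          if j = k then ((k.factorial : ℝ)⁻¹ * h ^ k) • iteratedDeriv k g 0 else 0 := by
        intro j hj
        rw [← Finset.sum_smul, hid j 0 ⟨le_rfl, hh.le⟩]
        have e : ∑ i ∈ Finset.range (2 * k), c i * ((j.factorial : ℝ)⁻¹ * x i ^ j) =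
            ((j.factorial : ℝ)⁻¹ * h ^ j) *
              ∑ i ∈ Finset.range (2 * k), c i * ((i : ℝ) / (2 * k : ℕ)) ^ j := by
          rw [Finset.mul_sum]
          refine Finset.sum_congr rfl fun i _ => ?_
          simp only [hx, mul_pow]
          ring
        rw [e, hc j (Finset.mem_range.1 hj)]
        split_ifs with hjk
        · rw [hjk, mul_one]
        · simp
      rw [Finset.sum_congr rfl this]
      simp [hk]
    have hle : ‖((k.factorial : ℝ)⁻¹ * h ^ k) • iteratedDeriv k g 0‖ ≤
        12 ^ (2 * k) * (A + B * h ^ (2 * k) / n.factorial) := by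
      rw [← hsum]
      refine (norm_sum_le _ _).trans ?_
      calc _ ≤ ∑ i ∈ Finset.range (2 * k), |c i| * (A + B * h ^ (2 * k) / n.factorial) := by
            refine Finset.sum_le_sum fun i hi => ?_
            rw [norm_smul, Real.norm_eq_abs]
            gcongr
            have h1 := hT i hi
            have h2 := hgA (x i) (hx0 i)
            calc _ = ‖g (x i) - (g (x i) - taylorWithinEval g n (Icc 0 h) 0 (x i))‖ := by
                  rw [sub_sub_cancel]
              _ ≤ _ := norm_sub_le _ _
              _ ≤ _ := by linarith
        _ = (∑ i ∈ Finset.range (2 * k), |c i|) * (A + B * h ^ (2 * k) / n.factorial) := by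
            rw [Finset.sum_mul]
        _ ≤ _ := by gcongr
    rw [norm_smul, Real.norm_of_nonneg (by positivity)] at hle
    have hf : (0 : ℝ) < k.factorial := by positivity
    calc _ = k.factorial * ((k.factorial : ℝ)⁻¹ * h ^ k * ‖iteratedDeriv k g 0‖) := by
          field_simp
      _ ≤ _ := by gcongr
  -- the optimal step equates the two contributions
  obtain ⟨h, hh, hhk⟩ : ∃ h : ℝ, 0 < h ∧ h ^ (2 * k) = n.factorial * A / B :=
    ⟨(n.factorial * A / B) ^ (((2 * k : ℕ) : ℝ)⁻¹), by positivity,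
      Real.rpow_inv_natCast_pow (by positivity) (by omega)⟩
  have h1 := main h hh
  rw [hhk] at h1
  have h2 : B * (n.factorial * A / B) / n.factorial = A := by field_simp
  rw [h2] at h1
  have h3 := pow_le_pow_left₀ (by positivity) h1 2
  rw [mul_pow, ← pow_mul, mul_comm k 2, hhk] at h3
  have hfac : (k.factorial : ℝ) ^ 2 ≤ 2 ^ k * n.factorial := by
    have ha : k.factorial * k.factorial ≤ (2 * k).factorial := by
      rw [two_mul]
      exact Nat.le_of_dvd (Nat.factorial_pos _) (Nat.factorial_mul_factorial_dvd_factorial_add k k)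
    have hb : (2 * k).factorial = 2 * k * n.factorial := by rw [hn, Nat.factorial_succ]
    have hc' : 2 * k ≤ 2 ^ k := by
      obtain ⟨d, rfl⟩ : ∃ d, k = d + 1 := ⟨k - 1, by omega⟩
      have : d < 2 ^ d := Nat.lt_two_pow_self
      rw [pow_succ]
      omega
    have hd : k.factorial ^ 2 ≤ 2 ^ k * n.factorial := by
      rw [sq]
      exact (ha.trans hb.le).trans (Nat.mul_le_mul_right _ hc')
    exact_mod_cast hd
  have h5 : n.factorial * A / B * ‖iteratedDeriv k g 0‖ ^ 2 ≤
      (2 ^ k * n.factorial) * (12 ^ (2 * k) * (A + A)) ^ 2 := by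
    refine h3.trans ?_
    rw [mul_pow]
    gcongr
  have h6 : ‖iteratedDeriv k g 0‖ ^ 2 ≤ 2 ^ k * (12 ^ (2 * k) * (A + A)) ^ 2 * B / A := by
    rw [le_div_iff₀ hA]
    have : (0 : ℝ) < n.factorial := by positivity
    calc _ = (n.factorial * A / B * ‖iteratedDeriv k g 0‖ ^ 2) * B / n.factorial := by field_simp
      _ ≤ ((2 ^ k * n.factorial) * (12 ^ (2 * k) * (A + A)) ^ 2) * B / n.factorial := by gcongr
      _ = _ := by field_simp
  refine h6.trans ?_
  have h7 : 2 ^ k * (12 ^ (2 * k) * (A + A)) ^ 2 * B / A = 4 * (2 * 12 ^ 4) ^ k * A * B := by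
    have : ((12 : ℝ) ^ (2 * k)) ^ 2 = (12 ^ 4) ^ k := by
      rw [← pow_mul, ← pow_mul]; congr 1; ring
    rw [mul_pow, mul_pow 2, this]
    field_simp
    ring
  have h8 : (4 : ℝ) ≤ 4 ^ k := le_self_pow₀ (by norm_num) hk.ne'
  rw [h7, mul_assoc 4 2, mul_pow 4]
  gcongr

/-! ### Functions with weighted decay and their Fourier transforms -/

theorem norm_iteratedDeriv_comp_line (i : Fin N) {s : ℝ} (hs : |s| = 1) {f : RN N → ℂ}
    (hf : IsSmooth f) (x : RN N) (k : ℕ) (t : ℝ) :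
    ‖iteratedDeriv k (fun t : ℝ => f (x + (s * t) • EuclideanSpace.single i 1)) t‖ =
      ‖(pderivRN i)^[k] f (x + (s * t) • EuclideanSpace.single i 1)‖ := by
  have key : iteratedDeriv k (fun t : ℝ => f (x + (s * t) • EuclideanSpace.single i 1)) =
      fun t : ℝ => s ^ k • (pderivRN i)^[k] f (x + (s * t) • EuclideanSpace.single i 1) := by
    induction k with
    | zero => simp
    | succ k ih =>
      rw [iteratedDeriv_succ, ih]
      funext t
      have h1 : HasDerivAt (fun t : ℝ => x + (s * t) • EuclideanSpace.single i (1 : ℝ))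
          (s • EuclideanSpace.single i (1 : ℝ)) t := by
        have := (((hasDerivAt_id t).const_mul s).smul_const
          (EuclideanSpace.single i (1 : ℝ))).const_add x
        simpa using this
      have h2 := ((isSmooth_iterate_pderivRN i k hf).differentiable (by simp)
        (x + (s * t) • EuclideanSpace.single i 1)).hasFDerivAt
      have h3 := (h2.comp_hasDerivAt t h1).const_smul (s ^ k)
      rw [Function.iterate_succ_apply']
      refine h3.deriv.trans ?_
      rw [map_smul, smul_smul, ← pow_succ]
      rfl
  rw [key, norm_smul, norm_pow, Real.norm_eq_abs, hs, one_pow, one_mul]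

theorem exists_abs_eq_one_norm_le (i : Fin N) (x : RN N) : ∃ s : ℝ, |s| = 1 ∧ ∀ t : ℝ, 0 ≤ t →
    ‖x‖ ≤ ‖x + (s * t) • EuclideanSpace.single i (1 : ℝ)‖ := by
  obtain ⟨s, hs, hsx⟩ : ∃ s : ℝ, |s| = 1 ∧ 0 ≤ s * x i := by
    rcases le_total 0 (x i) with h | h
    · exact ⟨1, by simp, by simpa⟩
    · exact ⟨-1, by simp, by simpa⟩
  refine ⟨s, hs, fun t ht => ?_⟩
  have h : ‖x + (s * t) • EuclideanSpace.single i (1 : ℝ)‖ ^ 2 = ‖x‖ ^ 2 +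
      2 * ((s * t) * x i) + ‖(s * t) • EuclideanSpace.single i (1 : ℝ)‖ ^ 2 := by
    rw [norm_add_sq_real, inner_smul_right, EuclideanSpace.inner_single_right]
    simp
  have h2 : 0 ≤ (s * t) * x i := by nlinarith
  refine (pow_le_pow_iff_left₀ (norm_nonneg _) (norm_nonneg _) two_ne_zero).1 ?_
  rw [h, add_assoc]
  exact le_add_of_nonneg_right (by positivity)

/-- The half-line Landau-Kolmogorov inequality along the ray that starts at `x`, is parallel to the
`i`-th axis and points away from the origin; the weights `A`, `B` only have to be bounds outside
the ball of radius `‖x‖`. -/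
theorem norm_iterate_pderivRN_sq_le (i : Fin N) {f : RN N → ℂ} (hf : IsSmooth f) {k : ℕ}
    (hk : 0 < k) (x : RN N) {A B : ℝ} (hA : 0 < A) (hB : 0 < B)
    (hfA : ∀ y, ‖x‖ ≤ ‖y‖ → ‖f y‖ ≤ A)
    (hfB : ∀ y, ‖x‖ ≤ ‖y‖ → ‖(pderivRN i)^[2 * k] f y‖ ≤ B) :
    ‖(pderivRN i)^[k] f x‖ ^ 2 ≤ (4 * 2 * 12 ^ 4) ^ k * A * B := by
  obtain ⟨s, hs, hsx⟩ := exists_abs_eq_one_norm_le i x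
  have hg : ContDiff ℝ ((⊤ : ℕ∞) : WithTop ℕ∞)
      (fun t : ℝ => f (x + (s * t) • EuclideanSpace.single i (1 : ℝ))) :=
    hf.comp (by fun_prop)
  have h := norm_iteratedDeriv_zero_sq_le hg hk hA hB (fun t ht => hfA _ (hsx t ht))
    (fun t ht => by
      rw [norm_iteratedDeriv_comp_line i hs hf]
      exact hfB _ (hsx t ht))
  rw [norm_iteratedDeriv_comp_line i hs hf] at h
  simpa using h

theorem hasTemperateGrowth_inner_single (i : Fin N) :
    (fun x : RN N => inner ℝ x (EuclideanSpace.single i (1 : ℝ))).HasTemperateGrowth :=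
  ((innerSL ℝ).flip (EuclideanSpace.single i (1 : ℝ))).hasTemperateGrowth

theorem enorm_fourier_le (f : RN N → ℂ) (ξ : RN N) : ‖𝓕 f ξ‖ₑ ≤ ∫⁻ x, ‖f x‖ₑ := by
  rw [Real.fourier_eq]
  refine (enorm_integral_le_lintegral_enorm _).trans (le_of_eq ?_)
  refine lintegral_congr fun x => ?_
  rw [← ofReal_norm, ← ofReal_norm, Circle.norm_smul]

/-- Smooth functions all of whose derivatives decay faster than all `exp(-μ ω)`; there is no
uniformity in the order of the derivative. Membership in `S_ω` is this property for `f` and for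
its Fourier transform. -/
def HasWeightedDecay (ω : ℝ → ℝ) (f : RN N → ℂ) : Prop :=
  IsSmooth f ∧ ∀ μ : ℝ, 0 < μ → ∀ α : Fin N → ℕ,
    ∃ C : ℝ, ∀ x, Real.exp (μ * ω ‖x‖) * ‖mderiv α f x‖ ≤ C

namespace HasWeightedDecay

protected theorem pderivRN {f : RN N → ℂ} (hf : HasWeightedDecay ω f) (i : Fin N) :
    HasWeightedDecay ω (pderivRN i f) := by
  refine ⟨contDiff_pderivRN i hf.1, fun μ hμ α => ?_⟩
  rw [mderiv_pderivRN _ _ hf.1, ← mderiv_add_single _ _ hf.1]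
  exact hf.2 μ hμ _

protected theorem mderiv {f : RN N → ℂ} (hf : HasWeightedDecay ω f) (α : Fin N → ℕ) :
    HasWeightedDecay ω (mderiv α f) := by
  induction α using multiIndex_induction with
  | zero => rwa [mderiv_zero_index]
  | add_single α i ih => rw [mderiv_add_single _ _ hf.1]; exact ih.pderivRN i

theorem exists_norm_iteratedFDeriv_le {f : RN N → ℂ} (hf : HasWeightedDecay ω f) {μ : ℝ}
    (hμ : 0 < μ) (n : ℕ) :
    ∃ C : ℝ, ∀ x, Real.exp (μ * ω ‖x‖) * ‖iteratedFDeriv ℝ n f x‖ ≤ C := by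
  induction n generalizing f with
  | zero =>
    obtain ⟨C, hC⟩ := hf.2 μ hμ 0
    refine ⟨C, fun x => ?_⟩
    simpa [mderiv_zero_index] using hC x
  | succ n ih =>
    choose C hC using fun i => ih (hf.pderivRN i)
    set L : Fin N → ℂ →L[ℝ] RN N →L[ℝ] ℂ := fun i =>
      ContinuousLinearMap.smulRightL ℝ (RN N) ℂ (EuclideanSpace.proj i) with hL
    have hfd : fderiv ℝ f = fun x => ∑ i, (L i ∘ pderivRN i f) x := by
      funext x
      ext v
      have hv : v = ∑ i, v i • EuclideanSpace.single i (1 : ℝ) := by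
        have := (EuclideanSpace.basisFun (Fin N) ℝ).sum_repr v
        simpa using this.symm
      conv_lhs => rw [hv]
      simp [hL, pderivRN]
    have hs : ∀ i, ContDiff ℝ n (pderivRN i f) := fun i =>
      (contDiff_pderivRN i hf.1).of_le (by exact_mod_cast le_top)
    refine ⟨∑ i, ‖L i‖ * C i, fun x => ?_⟩
    rw [← norm_iteratedFDeriv_fderiv, hfd, iteratedFDeriv_fun_sum_apply
      (fun i _ => ((L i).contDiff.comp (hs i)).contDiffAt)]
    calc _ ≤ Real.exp (μ * ω ‖x‖) * ∑ i, ‖L i‖ * ‖iteratedFDeriv ℝ n (pderivRN i f) x‖ := by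
          gcongr
          refine (norm_sum_le _ _).trans (Finset.sum_le_sum fun i _ => ?_)
          exact (L i).norm_iteratedFDeriv_comp_left (hs i).contDiffAt le_rfl
      _ = ∑ i, ‖L i‖ * (Real.exp (μ * ω ‖x‖) * ‖iteratedFDeriv ℝ n (pderivRN i f) x‖) := by
          rw [Finset.mul_sum]
          exact Finset.sum_congr rfl fun i _ => by ring
      _ ≤ _ := by gcongr with i; exact hC i x

/-- A function with weighted decay as a Schwartz function, by condition `(γ)`. -/
def toSchwartz (hω : IsNonQuasianalyticWeight ω) {f : RN N → ℂ} (hf : HasWeightedDecay ω f) :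
    SchwartzMap (RN N) ℂ where
  toFun := f
  smooth' := hf.1
  decay' k n := by
    obtain ⟨μ, C, hμ, hC, h⟩ := hω.exists_pow_le_exp k
    obtain ⟨D, hD⟩ := hf.exists_norm_iteratedFDeriv_le hμ n
    refine ⟨C * D, fun x => ?_⟩
    have h1 := h ‖x‖ (norm_nonneg x)
    have h2 : ‖x‖ ^ k ≤ (1 + ‖x‖) ^ k := by gcongr; linarith
    calc _ ≤ C * Real.exp (μ * ω ‖x‖) * ‖iteratedFDeriv ℝ n f x‖ := by gcongr; linarith
      _ = C * (Real.exp (μ * ω ‖x‖) * ‖iteratedFDeriv ℝ n f x‖) := by ring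
      _ ≤ _ := by gcongr; exact hD x

theorem coe_toSchwartz (hω : IsNonQuasianalyticWeight ω) {f : RN N → ℂ}
    (hf : HasWeightedDecay ω f) : ⇑(hf.toSchwartz hω) = f := rfl

theorem fourier_pderivRN (hω : IsNonQuasianalyticWeight ω) {f : RN N → ℂ}
    (hf : HasWeightedDecay ω f) (i : Fin N) (ξ : RN N) :
    𝓕 (pderivRN i f) ξ = (2 * Real.pi * Complex.I) * (ξ i) * 𝓕 f ξ := by
  have h := DFunLike.congr_fun (SchwartzMap.fourier_lineDerivOp_eq (hf.toSchwartz hω)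
    (EuclideanSpace.single i (1 : ℝ))) ξ
  rw [smul_apply, SchwartzMap.smulLeftCLM_apply_apply
    (hasTemperateGrowth_inner_single i), EuclideanSpace.inner_single_right] at h
  simp only [SchwartzMap.fourier_coe] at h
  refine h.trans ?_
  simp [coe_toSchwartz, mul_assoc]

theorem pderivRN_fourier (hω : IsNonQuasianalyticWeight ω) {f : RN N → ℂ}
    (hf : HasWeightedDecay ω f) (i : Fin N) :
    pderivRN i (𝓕 f) = 𝓕 (fun x => (-(2 * Real.pi * Complex.I)) * ((x i : ℂ) * f x)) := by
  have h := SchwartzMap.lineDerivOp_fourier_eq (hf.toSchwartz hω)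
    (EuclideanSpace.single i (1 : ℝ))
  have h2 := congrArg (fun F : SchwartzMap (RN N) ℂ => (F : RN N → ℂ)) h
  simp only [SchwartzMap.fourier_coe] at h2
  refine Eq.trans ?_ (h2.trans ?_)
  · rfl
  · congr 1
    funext x
    rw [smul_apply, SchwartzMap.smulLeftCLM_apply_apply
      (hasTemperateGrowth_inner_single i), EuclideanSpace.inner_single_right]
    simp [coe_toSchwartz]

theorem norm_fourier_mderiv_le (hω : IsNonQuasianalyticWeight ω) {f : RN N → ℂ}
    (hf : HasWeightedDecay ω f) (α : Fin N → ℕ) (ξ : RN N) :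
    ‖𝓕 (mderiv α f) ξ‖ ≤ (2 * Real.pi * ‖ξ‖) ^ (∑ i, α i) * ‖𝓕 f ξ‖ := by
  induction α using multiIndex_induction with
  | zero => simp [mderiv_zero_index]
  | add_single α i ih =>
    rw [mderiv_add_single _ _ hf.1, (hf.mderiv α).fourier_pderivRN hω, sum_add_single, pow_succ,
      norm_mul]
    have h1 : ‖(2 * Real.pi * Complex.I) * (ξ i : ℂ)‖ ≤ 2 * Real.pi * ‖ξ‖ := by
      have := PiLp.norm_apply_le ξ i
      simpa [abs_of_pos Real.pi_pos, Real.pi_pos] using this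
    calc _ ≤ (2 * Real.pi * ‖ξ‖) * ((2 * Real.pi * ‖ξ‖) ^ (∑ i, α i) * ‖𝓕 f ξ‖) := by gcongr
      _ = _ := by ring

theorem norm_fourier_iterate_pderivRN (hω : IsNonQuasianalyticWeight ω) {f : RN N → ℂ}
    (hf : HasWeightedDecay ω f) (i : Fin N) (k : ℕ) (ξ : RN N) :
    ‖𝓕 ((pderivRN i)^[k] f) ξ‖ = (2 * Real.pi * |ξ i|) ^ k * ‖𝓕 f ξ‖ := by
  induction k with
  | zero => simp
  | succ k ih =>
    have hk : HasWeightedDecay ω ((pderivRN i)^[k] f) := by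
      have := hf.mderiv (0 + Pi.single i k)
      rwa [mderiv_add_single_nat _ _ _ hf.1, mderiv_zero_index] at this
    rw [Function.iterate_succ_apply', hk.fourier_pderivRN hω, norm_mul, ih, pow_succ]
    simp [abs_of_pos Real.pi_pos]
    ring

theorem integrable (hω : IsNonQuasianalyticWeight ω) {f : RN N → ℂ}
    (hf : HasWeightedDecay ω f) : Integrable f := (hf.toSchwartz hω).integrable

theorem isSmooth_fourier (hω : IsNonQuasianalyticWeight ω) {f : RN N → ℂ}
    (hf : HasWeightedDecay ω f) : IsSmooth (𝓕 f) := (𝓕 (hf.toSchwartz hω)).smooth'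

theorem enorm_le_lintegral_fourier (hω : IsNonQuasianalyticWeight ω) {f : RN N → ℂ}
    (hf : HasWeightedDecay ω f) (x : RN N) : ‖f x‖ₑ ≤ ∫⁻ ξ, ‖𝓕 f ξ‖ₑ := by
  have h : f x = 𝓕⁻ (𝓕 f) x := by
    have := DFunLike.congr_fun (FourierTransform.fourierInv_fourier_eq
      (F := SchwartzMap (RN N) ℂ) (hf.toSchwartz hω)) x
    rw [SchwartzMap.fourierInv_coe, SchwartzMap.fourier_coe] at this
    exact this.symm
  rw [h, Real.fourierInv_eq_fourier_neg]
  exact enorm_fourier_le _ _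

end HasWeightedDecay

/-! ### Finiteness of the norms `q_{lam,μ}` on `S_ω` -/

namespace IsNonQuasianalyticWeight

theorem continuous_comp_norm (hω : IsNonQuasianalyticWeight ω) :
    Continuous fun x : RN N => ω ‖x‖ :=
  hω.continuousOn.comp_continuous continuous_norm fun x => norm_nonneg x

theorem measurable_exp_mul_comp_norm (hω : IsNonQuasianalyticWeight ω) (μ : ℝ) :
    Measurable fun x : RN N => ENNReal.ofReal (Real.exp (μ * ω ‖x‖)) :=
  ENNReal.measurable_ofReal.comp
    (Real.continuous_exp.comp (continuous_const.mul hω.continuous_comp_norm)).measurable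

theorem exists_lintegral_exp_ne_top (N : ℕ) (hω : IsNonQuasianalyticWeight ω) :
    ∃ μ : ℝ, 0 < μ ∧ ∫⁻ x : RN N, ENNReal.ofReal (Real.exp (-μ * ω ‖x‖)) ≠ ∞ := by
  obtain ⟨μ, C, hμ, hC, h⟩ := hω.exists_pow_le_exp (N + 1)
  refine ⟨μ, hμ, ?_⟩
  have hint : Integrable (fun x : RN N => C * (1 + ‖x‖) ^ (-((N + 1 : ℕ) : ℝ))) := by
    refine (integrable_one_add_norm ?_).const_mul C
    simp
  refine ne_top_of_le_ne_top hint.lintegral_lt_top.ne (lintegral_mono fun x => ?_)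
  apply ENNReal.ofReal_le_ofReal
  have hx : 0 < 1 + ‖x‖ := by positivity
  have h1 := h ‖x‖ (norm_nonneg x)
  rw [Real.rpow_neg hx.le, Real.rpow_natCast, neg_mul, Real.exp_neg, ← div_eq_mul_inv,
    le_div_iff₀ (by positivity), inv_mul_le_iff₀ (Real.exp_pos _)]
  linarith

end IsNonQuasianalyticWeight

namespace HasWeightedDecay

/-- Fourier inversion turns the decay of `𝓕 f` into bounds on the derivatives of `f` that are
uniform in the order. -/
theorem exists_enorm_mderiv_le (hω : IsNonQuasianalyticWeight ω) {f : RN N → ℂ}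
    (hf : HasWeightedDecay ω f) (hF : HasWeightedDecay ω (𝓕 f)) {lam : ℝ} (hlam : 0 < lam) :
    ∃ C : ℝ, 0 < C ∧ ∀ α x,
      ‖mderiv α f x‖ₑ ≤ ENNReal.ofReal C * powerWeight ω lam (∑ i, α i) := by
  obtain ⟨lam', hl, C₃, hC₃, hW⟩ := hω.exists_pow_mul_powerWeight_le (2 * Real.pi) hlam
  obtain ⟨μ, hμ, hI⟩ := hω.exists_lintegral_exp_ne_top N
  have hl0 : 0 < lam' := by linarith
  -- The part `lam'` of the decay absorbs the power of `ξ`; the part `μ` makes the rest integrable.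
  obtain ⟨D, hD⟩ := hF.2 (lam' + μ) (by positivity) 0
  simp only [mderiv_zero_index] at hD
  set I := ∫⁻ x : RN N, ENNReal.ofReal (Real.exp (-μ * ω ‖x‖))
  set K := ENNReal.ofReal C₃ * ENNReal.ofReal (Real.exp (lam' * ω 1)) * ENNReal.ofReal D * I
    with hK
  have hKtop : K ≠ ∞ := by
    simp only [hK]
    exact ENNReal.mul_ne_top (ENNReal.mul_ne_top (ENNReal.mul_ne_top ENNReal.ofReal_ne_top
      ENNReal.ofReal_ne_top) ENNReal.ofReal_ne_top) hI
  refine ⟨K.toReal + 1, by positivity, fun α x => ?_⟩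
  set k := ∑ i, α i
  have hpt : ∀ ξ, ‖𝓕 (mderiv α f) ξ‖ₑ ≤ (ENNReal.ofReal ((2 * Real.pi) ^ k) *
      powerWeight ω lam' k * (ENNReal.ofReal (Real.exp (lam' * ω 1)) * ENNReal.ofReal D)) *
        ENNReal.ofReal (Real.exp (-μ * ω ‖ξ‖)) := by
    intro ξ
    have h1 := hf.norm_fourier_mderiv_le hω α ξ
    have h2 : ‖𝓕 f ξ‖ ≤ D * Real.exp (-lam' * ω ‖ξ‖) * Real.exp (-μ * ω ‖ξ‖) := by
      have := hD ξ
      have e : Real.exp (-lam' * ω ‖ξ‖) * Real.exp (-μ * ω ‖ξ‖) =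
          (Real.exp ((lam' + μ) * ω ‖ξ‖))⁻¹ := by
        rw [← Real.exp_add, ← Real.exp_neg]; congr 1; ring
      rw [mul_assoc, e, ← div_eq_mul_inv, le_div_iff₀ (Real.exp_pos _)]
      linarith
    have hD0 : 0 ≤ D := le_trans (by positivity) (hD 0)
    have h3 := hω.ofReal_pow_le_of_nonneg hl0.le (norm_nonneg ξ) k
    have hone : ENNReal.ofReal (Real.exp (lam' * ω ‖ξ‖)) *
        ENNReal.ofReal (Real.exp (-lam' * ω ‖ξ‖)) = 1 := by
      rw [← ENNReal.ofReal_mul (Real.exp_pos _).le, ← Real.exp_add]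
      simp
    rw [← ofReal_norm]
    calc _ ≤ ENNReal.ofReal ((2 * Real.pi) ^ k * ‖ξ‖ ^ k *
          (D * Real.exp (-lam' * ω ‖ξ‖) * Real.exp (-μ * ω ‖ξ‖))) := by
          apply ENNReal.ofReal_le_ofReal
          rw [← mul_pow]
          exact h1.trans (by gcongr)
      _ = ENNReal.ofReal ((2 * Real.pi) ^ k) * ENNReal.ofReal (‖ξ‖ ^ k) *
          (ENNReal.ofReal D * ENNReal.ofReal (Real.exp (-lam' * ω ‖ξ‖)) *
            ENNReal.ofReal (Real.exp (-μ * ω ‖ξ‖))) := by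
          rw [← ENNReal.ofReal_mul hD0, ← ENNReal.ofReal_mul (by positivity),
            ← ENNReal.ofReal_mul (by positivity), ← ENNReal.ofReal_mul (by positivity)]
      _ ≤ ENNReal.ofReal ((2 * Real.pi) ^ k) * (ENNReal.ofReal (Real.exp (lam' * ω 1)) *
          powerWeight ω lam' k * ENNReal.ofReal (Real.exp (lam' * ω ‖ξ‖))) *
          (ENNReal.ofReal D * ENNReal.ofReal (Real.exp (-lam' * ω ‖ξ‖)) *
            ENNReal.ofReal (Real.exp (-μ * ω ‖ξ‖))) :=
          mul_le_mul_left (mul_le_mul_right h3 _) _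
      _ = (ENNReal.ofReal ((2 * Real.pi) ^ k) *
      powerWeight ω lam' k * (ENNReal.ofReal (Real.exp (lam' * ω 1)) * ENNReal.ofReal D)) *
        ENNReal.ofReal (Real.exp (-μ * ω ‖ξ‖)) * (ENNReal.ofReal (Real.exp (lam' * ω ‖ξ‖)) *
          ENNReal.ofReal (Real.exp (-lam' * ω ‖ξ‖))) := by ring
      _ = _ := by rw [hone, mul_one]
  calc _ ≤ ∫⁻ ξ, ‖𝓕 (mderiv α f) ξ‖ₑ := (hf.mderiv α).enorm_le_lintegral_fourier hω x
    _ ≤ _ := lintegral_mono hpt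
    _ = _ * I := lintegral_const_mul _ (hω.measurable_exp_mul_comp_norm (-μ))
    _ ≤ (ENNReal.ofReal C₃ * powerWeight ω lam k *
        (ENNReal.ofReal (Real.exp (lam' * ω 1)) * ENNReal.ofReal D)) * I :=
      mul_le_mul_left (mul_le_mul_left (hW k) _) _
    _ = K * powerWeight ω lam k := by rw [hK]; ring
    _ ≤ _ := by
      refine mul_le_mul_left ?_ _
      rw [← ENNReal.ofReal_toReal hKtop]
      apply ENNReal.ofReal_le_ofReal
      simp [ENNReal.toReal_ofReal]

/-- The Landau-Kolmogorov inequality interpolates between the decay of `f` and the uniform bounds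
on its derivatives, one coordinate direction at a time. -/
theorem exists_enorm_mderiv_mul_exp_le (hω : IsNonQuasianalyticWeight ω) {f : RN N → ℂ}
    (hf : HasWeightedDecay ω f) (hF : HasWeightedDecay ω (𝓕 f)) (S : Finset (Fin N))
    {lam μ : ℝ} (hlam : 0 < lam) (hμ : 0 < μ) :
    ∃ C : ℝ, 0 < C ∧ ∀ α : Fin N → ℕ, (∀ i ∉ S, α i = 0) →
      powerWeight ω lam (∑ i, α i) ≠ ∞ → ∀ x,
      ‖mderiv α f x‖ * Real.exp (μ * ω ‖x‖) ≤
        C * (powerWeight ω lam (∑ i, α i)).toReal := by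
  induction S using Finset.induction_on generalizing lam μ with
  | empty =>
    obtain ⟨C, hC⟩ := hf.2 μ hμ 0
    have hC0 : 0 ≤ C := le_trans (by positivity) (hC 0)
    refine ⟨(C + 1) * Real.exp (lam * ω 1), by positivity, fun α hα htop x => ?_⟩
    obtain rfl : α = 0 := funext fun i => hα i (by simp)
    have h1 := (ENNReal.ofReal_le_iff_le_toReal htop).1
      (le_powerWeight (ω := ω) lam _)
    calc _ ≤ C + 1 := by rw [mul_comm]; linarith [hC x]
      _ = (C + 1) * Real.exp (lam * ω 1) * Real.exp (-lam * ω 1) := by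
        rw [mul_assoc, ← Real.exp_add]; simp
      _ ≤ _ := by gcongr
  | insert i S hi ih =>
    set D : ℝ := 4 * 2 * 12 ^ 4 with hD
    have hD1 : 1 ≤ D := by norm_num [hD]
    obtain ⟨l, hl, C₃, hC₃, hW⟩ := hω.exists_pow_mul_powerWeight_le D hlam
    have hl0 : 0 < l := by linarith
    obtain ⟨C₀, hC₀, h₀⟩ := ih hlam hμ
    -- The parameters are doubled because the interpolation takes a square root of the product of
    -- the bounds for the orders `0` and `2 * k` in direction `i`.
    obtain ⟨C₁, hC₁, h₁⟩ := ih (lam := 2 * l) (μ := 2 * μ) (by positivity) (by positivity)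
    obtain ⟨C₂, hC₂, h₂⟩ := hf.exists_enorm_mderiv_le hω hF (lam := 2 * l) (by positivity)
    refine ⟨C₀ + (C₁ + C₂) * C₃, by positivity, fun α hα htop x => ?_⟩
    -- Without a derivative in direction `i` the induction hypothesis applies as it stands.
    rcases Nat.eq_zero_or_pos (α i) with hk | hk
    · refine (h₀ α (fun j hj => ?_) htop x).trans ?_
      · by_cases hji : j = i
        · rw [hji, hk]
        · exact hα j (by simp [hji, hj])
      · gcongr
        exact le_add_of_nonneg_right (by positivity)
    obtain ⟨β, k, hβ, hkα, rfl⟩ : ∃ (β : Fin N → ℕ) (k : ℕ), β i = 0 ∧ 0 < k ∧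
        α = β + Pi.single i k := by
      refine ⟨Function.update α i 0, α i, by simp, hk, funext fun j => ?_⟩
      by_cases hj : j = i
      · subst hj; simp
      · simp [hj]
    have hβS : ∀ j ∉ S, β j = 0 := by
      intro j hj
      by_cases hji : j = i
      · rw [hji, hβ]
      · simpa [hji] using hα j (by simp [hji, hj])
    rw [sum_add_single] at htop ⊢
    set b := ∑ j, β j with hb
    -- finiteness of the weights involved
    have hlW : powerWeight ω l (b + k) ≠ ∞ :=
      ((hω.powerWeight_anti hl _).trans_lt htop.lt_top).ne
    have hprod : powerWeight ω (2 * l) b * powerWeight ω (2 * l) (b + 2 * k) ≤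
        powerWeight ω l (b + k) ^ 2 := by
      refine (hω.powerWeight_mul_le (by positivity) _ _).trans ?_
      rw [show b + (b + 2 * k) = 2 * (b + k) by ring]
      exact powerWeight_two_mul _ _
    have hprodtop := ne_top_of_le_ne_top (ENNReal.pow_ne_top hlW) hprod
    have hW1 := (ENNReal.lt_top_of_mul_ne_top_left hprodtop
      (powerWeight_ne_zero _ _)).ne
    have hW2 := (ENNReal.lt_top_of_mul_ne_top_right hprodtop
      (powerWeight_ne_zero _ _)).ne
    have hWpos : ∀ (l : ℝ) (k : ℕ), powerWeight ω l k ≠ ∞ → 0 < (powerWeight ω l k).toReal :=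
      fun l k h => ENNReal.toReal_pos (powerWeight_ne_zero _ _) h
    have hw1 := hWpos _ _ hW1
    have hw2 := hWpos _ _ hW2
    have hw := hWpos _ _ htop
    have hwl := hWpos _ _ hlW
    have hprod' : (powerWeight ω (2 * l) b).toReal * (powerWeight ω (2 * l) (b + 2 * k)).toReal ≤
        (powerWeight ω l (b + k)).toReal ^ 2 := by
      rw [← ENNReal.toReal_mul, ← ENNReal.toReal_pow]
      exact ENNReal.toReal_mono (ENNReal.pow_ne_top hlW) hprod
    have hWk : D ^ (b + k) * (powerWeight ω l (b + k)).toReal ≤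
        C₃ * (powerWeight ω lam (b + k)).toReal := by
      have := ENNReal.toReal_mono (ENNReal.mul_ne_top ENNReal.ofReal_ne_top htop) (hW (b + k))
      rwa [ENNReal.toReal_mul, ENNReal.toReal_mul, ENNReal.toReal_ofReal (by positivity),
        ENNReal.toReal_ofReal hC₃.le] at this
    have hfA : ∀ y : RN N, ‖x‖ ≤ ‖y‖ → ‖mderiv β f y‖ ≤
        C₁ * (powerWeight ω (2 * l) b).toReal * Real.exp (-(2 * μ) * ω ‖x‖) := by
      intro y hxy
      have h := h₁ β hβS hW1 y
      have hω' : ω ‖x‖ ≤ ω ‖y‖ := hω.monotoneOn (norm_nonneg x) (norm_nonneg y) hxy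
      calc _ = ‖mderiv β f y‖ * Real.exp (2 * μ * ω ‖x‖) *
            Real.exp (-(2 * μ) * ω ‖x‖) := by rw [mul_assoc, ← Real.exp_add]; simp
        _ ≤ ‖mderiv β f y‖ * Real.exp (2 * μ * ω ‖y‖) * Real.exp (-(2 * μ) * ω ‖x‖) := by
            gcongr
        _ ≤ _ := by gcongr
    have hfB : ∀ y : RN N, ‖x‖ ≤ ‖y‖ → ‖(pderivRN i)^[2 * k] (mderiv β f) y‖ ≤
        C₂ * (powerWeight ω (2 * l) (b + 2 * k)).toReal := by
      intro y _
      have h := h₂ (β + Pi.single i (2 * k)) y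
      rw [sum_add_single, mderiv_add_single_nat _ _ _ hf.1] at h
      have h' := ENNReal.toReal_mono (ENNReal.mul_ne_top ENNReal.ofReal_ne_top hW2) h
      rwa [ENNReal.toReal_mul, ENNReal.toReal_ofReal hC₂.le, toReal_enorm] at h'
    have key := norm_iterate_pderivRN_sq_le i (isSmooth_mderiv β hf.1) hkα x (by positivity)
      (by positivity) hfA hfB
    rw [mderiv_add_single_nat _ _ _ hf.1]
    generalize (powerWeight ω (2 * l) b).toReal = w1 at *
    generalize (powerWeight ω (2 * l) (b + 2 * k)).toReal = w2 at *
    generalize (powerWeight ω lam (b + k)).toReal = w at *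
    generalize (powerWeight ω l (b + k)).toReal = wl at *
    have hDk : D ^ k ≤ (D ^ (b + k)) ^ 2 := by
      rw [← pow_mul]
      exact pow_le_pow_right₀ hD1 (by omega)
    have hexp : Real.exp (-(2 * μ) * ω ‖x‖) * Real.exp (μ * ω ‖x‖) ^ 2 = 1 := by
      rw [← Real.exp_nat_mul, ← Real.exp_add]
      simp [mul_assoc]
    have hsq : (‖(pderivRN i)^[k] (mderiv β f) x‖ * Real.exp (μ * ω ‖x‖)) ^ 2 ≤
        ((C₁ + C₂) * C₃ * w) ^ 2 := by
      calc _ = ‖(pderivRN i)^[k] (mderiv β f) x‖ ^ 2 *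
            Real.exp (μ * ω ‖x‖) ^ 2 := mul_pow _ _ _
        _ ≤ D ^ k * (C₁ * w1 * Real.exp (-(2 * μ) * ω ‖x‖)) * (C₂ * w2) *
            Real.exp (μ * ω ‖x‖) ^ 2 := by gcongr
        _ = C₁ * C₂ * (D ^ k * (w1 * w2)) *
            (Real.exp (-(2 * μ) * ω ‖x‖) * Real.exp (μ * ω ‖x‖) ^ 2) := by ring
        _ = C₁ * C₂ * (D ^ k * (w1 * w2)) := by rw [hexp, mul_one]
        _ ≤ C₁ * C₂ * ((D ^ (b + k)) ^ 2 * wl ^ 2) := by gcongr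
        _ = C₁ * C₂ * (D ^ (b + k) * wl) ^ 2 := by ring
        _ ≤ (C₁ + C₂) ^ 2 * (C₃ * w) ^ 2 := by
            gcongr
            nlinarith
        _ = _ := by ring
    refine ((pow_le_pow_iff_left₀ (by positivity) (by positivity) two_ne_zero).1 hsq).trans ?_
    have : 0 ≤ C₀ * w := by positivity
    linarith

theorem qNorm_lt_top (hω : IsNonQuasianalyticWeight ω) {f : RN N → ℂ}
    (hf : HasWeightedDecay ω f) (hF : HasWeightedDecay ω (𝓕 f)) {lam μ : ℝ} (hlam : 0 < lam)
    (hμ : 0 < μ) : qNorm ω lam μ f < ∞ := by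
  obtain ⟨C, hC, h⟩ := hf.exists_enorm_mderiv_mul_exp_le hω hF Finset.univ hlam hμ
  refine (weightedSup_le (C := ENNReal.ofReal C) hlam fun α hα x => ?_).trans_lt
    ENNReal.ofReal_lt_top
  rw [← ENNReal.ofReal_toReal hα, ← ENNReal.ofReal_mul hC.le, ← ofReal_norm,
    ← ENNReal.ofReal_mul (norm_nonneg _)]
  exact ENNReal.ofReal_le_ofReal (h α (by simp) hα x)

end HasWeightedDecay

/-! ### Description of `S_ω` by the norms `q_{lam,μ}` -/

/-- Smooth functions for which all the norms `q_{lam,μ}` are finite. -/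
def HasFiniteQNorms (ω : ℝ → ℝ) (f : RN N → ℂ) : Prop :=
  IsSmooth f ∧ ∀ lam μ : ℝ, 0 < lam → 0 < μ → qNorm ω lam μ f < ∞

/-- The coordinate function `x ↦ x_i`. -/
def coordRN (i : Fin N) : RN N → ℂ := fun x => (x i : ℂ)

theorem isSmooth_coordRN (i : Fin N) : IsSmooth (coordRN i) :=
  Complex.ofRealCLM.contDiff.comp (EuclideanSpace.proj (𝕜 := ℝ) i).contDiff

theorem pderivRN_coordRN (i j : Fin N) :
    pderivRN j (coordRN i) = fun _ => if i = j then 1 else 0 := by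
  funext x
  have h : HasFDerivAt (coordRN i)
      (Complex.ofRealCLM.comp (EuclideanSpace.proj (𝕜 := ℝ) i : RN N →L[ℝ] ℝ)) x :=
    (Complex.ofRealCLM.comp (EuclideanSpace.proj (𝕜 := ℝ) i : RN N →L[ℝ] ℝ)).hasFDerivAt
  rw [pderivRN, h.fderiv]
  by_cases hij : i = j <;> simp [hij]

theorem norm_mderiv_coordRN_le (i : Fin N) (α : Fin N → ℕ) (x : RN N) :
    ‖mderiv α (coordRN i) x‖ ≤ 1 + ‖x‖ := by
  have key : mderiv α (coordRN i) = coordRN i ∨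
      ∃ z : ℂ, ‖z‖ ≤ 1 ∧ mderiv α (coordRN i) = fun _ => z := by
    induction α using multiIndex_induction with
    | zero => exact Or.inl (mderiv_zero_index _)
    | add_single α j ih =>
      right
      rw [mderiv_add_single _ _ (isSmooth_coordRN i)]
      rcases ih with h | ⟨z, hz, h⟩
      · refine ⟨if i = j then 1 else 0, by split_ifs <;> simp, ?_⟩
        rw [h, pderivRN_coordRN]
      · refine ⟨0, by simp, ?_⟩
        rw [h]
        funext x
        simp [pderivRN]
  rcases key with h | ⟨z, hz, h⟩
  · rw [h]
    have := PiLp.norm_apply_le x i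
    simp only [coordRN, Complex.norm_real]
    linarith
  · rw [h]
    linarith [norm_nonneg x]

theorem exists_weightedSup_coordRN_lt_top (hω : IsNonQuasianalyticWeight ω) (i : Fin N) :
    ∃ μ : ℝ, 0 < μ ∧ ∀ lam : ℝ, 0 < lam → weightedSup ω lam (-μ) (coordRN i) < ∞ := by
  obtain ⟨μ, C, hμ, hC, h⟩ := hω.exists_pow_le_exp 1
  refine ⟨μ, hμ, fun lam hlam => ?_⟩
  refine (weightedSup_le (C := ENNReal.ofReal (C * Real.exp (lam * ω 1))) hlam
    fun α _ x => ?_).trans_lt ENNReal.ofReal_lt_top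
  calc _ ≤ ENNReal.ofReal (C * Real.exp (lam * ω 1)) *
        ENNReal.ofReal (Real.exp (-lam * ω 1)) := by
        rw [← ofReal_norm, ← ENNReal.ofReal_mul (norm_nonneg _),
          ← ENNReal.ofReal_mul (by positivity)]
        apply ENNReal.ofReal_le_ofReal
        have h1 := h ‖x‖ (norm_nonneg x)
        rw [pow_one] at h1
        calc _ ≤ C * Real.exp (μ * ω ‖x‖) * Real.exp (-μ * ω ‖x‖) := by
              gcongr
              exact (norm_mderiv_coordRN_le i α x).trans h1
          _ = C := by rw [mul_assoc, ← Real.exp_add]; simp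
          _ = _ := by rw [mul_assoc, ← Real.exp_add]; simp
    _ ≤ _ := mul_le_mul_right (le_powerWeight _ _) _

theorem exists_norm_le_mul_abs (ξ : RN N) (hξ : ξ ≠ 0) : ∃ j, ‖ξ‖ ≤ N * |ξ j| := by
  by_contra! hc
  have h1 : ‖ξ‖ ≤ ∑ j, |ξ j| := by
    have := (EuclideanSpace.basisFun (Fin N) ℝ).sum_repr ξ
    conv_lhs => rw [← this]
    refine (norm_sum_le _ _).trans (le_of_eq ?_)
    simp [norm_smul]
  have hN : Nonempty (Fin N) := by
    by_contra hN
    rw [not_nonempty_iff] at hN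
    exact hξ (by ext j; exact hN.elim j)
  have h2 : ∑ j, N * |ξ j| < ∑ _j : Fin N, ‖ξ‖ :=
    Finset.sum_lt_sum_of_nonempty Finset.univ_nonempty fun j _ => hc j
  rw [← Finset.mul_sum] at h2
  simp only [Finset.sum_const, Finset.card_univ, Fintype.card_fin, nsmul_eq_mul] at h2
  have hN' : (0 : ℝ) ≤ N := by positivity
  nlinarith

namespace HasFiniteQNorms

theorem const_smul {f : RN N → ℂ} (hf : HasFiniteQNorms ω f) (c : ℂ) :
    HasFiniteQNorms ω (c • f) := by
  refine ⟨hf.1.const_smul c, fun lam μ hlam hμ => ?_⟩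
  rw [qNorm, weightedSup_smul _ _ _ c hf.1]
  exact ENNReal.mul_lt_top enorm_lt_top (hf.2 lam μ hlam hμ)

/-- If for every `m` some `r_{m,n}(f)` is finite, then multiplication by `f` preserves the finiteness
of all the norms `q_{lam,μ}`. -/
theorem mul_left (hω : IsNonQuasianalyticWeight ω) {f g : RN N → ℂ} (hf : IsSmooth f)
    (hfr : ∀ m : ℕ+, ∃ μ : ℝ, 0 ≤ μ ∧ weightedSup ω (m : ℝ) (-μ) f < ∞)
    (hg : HasFiniteQNorms ω g) : HasFiniteQNorms ω (f * g) := by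
  refine ⟨hf.mul hg.1, fun lam μ hlam hμ => ?_⟩
  obtain ⟨m₀, C, hC, h⟩ := exists_weightedSup_mul_le (N := N) hω hlam
  obtain ⟨m, hm⟩ := exists_nat_ge m₀
  set m' : ℕ+ := ⟨m + 1, Nat.succ_pos m⟩
  have hm' : ((m' : ℕ) : ℝ) = m + 1 := by simp [m']
  obtain ⟨ν, hν, hfν⟩ := hfr m'
  have hm0 : (0 : ℝ) < (m' : ℕ) := by rw [hm']; positivity
  have h1 := h (m' : ℕ) (by rw [hm']; linarith) hm0 (-ν) (ν + μ) f g hf hg.1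
  rw [neg_add_cancel_left] at h1
  refine h1.trans_lt (ENNReal.mul_lt_top hC.lt_top (ENNReal.mul_lt_top hfν ?_))
  exact hg.2 _ _ hm0 (by positivity)

theorem coordRN_mul (hω : IsNonQuasianalyticWeight ω) {f : RN N → ℂ}
    (hf : HasFiniteQNorms ω f) (i : Fin N) : HasFiniteQNorms ω (coordRN i * f) := by
  obtain ⟨μ, hμ, h⟩ := exists_weightedSup_coordRN_lt_top hω i
  exact hf.mul_left hω (isSmooth_coordRN i) fun m => ⟨μ, hμ.le, h _ (by exact_mod_cast m.pos)⟩

theorem hasWeightedDecay (hω : IsNonQuasianalyticWeight ω) {f : RN N → ℂ}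
    (hf : HasFiniteQNorms ω f) : HasWeightedDecay ω f := by
  refine ⟨hf.1, fun μ hμ α => ?_⟩
  obtain ⟨lam, hlam, hW⟩ := hω.exists_powerWeight_ne_top (∑ i, α i)
  refine ⟨(qNorm ω lam μ f * powerWeight ω lam (∑ i, α i)).toReal, fun x => ?_⟩
  rw [← ENNReal.ofReal_le_iff_le_toReal (ENNReal.mul_ne_top (hf.2 lam μ hlam hμ).ne hW),
    mul_comm, ENNReal.ofReal_mul (norm_nonneg _), ofReal_norm]
  exact enorm_mderiv_mul_le hlam α hW x

/-- Uniform bounds on the derivatives of `f` give decay of `𝓕 f`, since the weight `ω` is recovered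
from the sequence `powerWeight ω lam`. -/
theorem exists_exp_mul_fourier_le (hω : IsNonQuasianalyticWeight ω) {f : RN N → ℂ}
    (hf : HasFiniteQNorms ω f) {lam : ℝ} (hlam : 0 < lam) :
    ∃ C : ℝ, ∀ ξ, Real.exp (lam * ω ‖ξ‖) * ‖𝓕 f ξ‖ ≤ C := by
  have hfd := hf.hasWeightedDecay hω
  obtain ⟨μ₁, C₁, hμ₁, hC₁, h₁⟩ := hω.exists_pow_le_exp 1
  -- The extra `μ₁` pays for the factor `‖ξ‖` lost in `exists_powerWeight_mul_exp_le`.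
  obtain ⟨l, hl, C₃, hC₃, hW⟩ := hω.exists_pow_mul_powerWeight_le N
    (lam := lam + μ₁) (by positivity)
  have hl0 : 0 < l := by linarith
  obtain ⟨μ, hμ, hI⟩ := hω.exists_lintegral_exp_ne_top N
  set I := ∫⁻ x : RN N, ENNReal.ofReal (Real.exp (-μ * ω ‖x‖))
  set Q := qNorm ω l μ f with hQ
  have hQtop : Q ≠ ∞ := (hf.2 l μ hl0 hμ).ne
  have hfour : ∀ (j : Fin N) (k : ℕ), powerWeight ω l k ≠ ∞ → ∀ ξ,
      ENNReal.ofReal ((2 * Real.pi * |ξ j|) ^ k * ‖𝓕 f ξ‖) ≤ Q * powerWeight ω l k * I := by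
    intro j k hk ξ
    rw [← hfd.norm_fourier_iterate_pderivRN hω, ofReal_norm]
    refine (enorm_fourier_le _ _).trans ?_
    rw [← lintegral_const_mul _ (hω.measurable_exp_mul_comp_norm (-μ))]
    refine lintegral_mono fun x => ?_
    have hs : ∑ i, (0 + Pi.single j k : Fin N → ℕ) i = k := by rw [sum_add_single]; simp
    have h := enorm_mderiv_mul_le (f := f) (μ := μ) hl0 (0 + Pi.single j k) (by rwa [hs]) x
    rw [hs, mderiv_add_single_nat _ _ _ hf.1, mderiv_zero_index] at h
    calc _ = ‖(pderivRN j)^[k] f x‖ₑ * ENNReal.ofReal (Real.exp (μ * ω ‖x‖)) *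
          ENNReal.ofReal (Real.exp (-μ * ω ‖x‖)) := by
          rw [mul_assoc, ← ENNReal.ofReal_mul (by positivity), ← Real.exp_add]; simp
      _ ≤ _ := mul_le_mul_left h _
  obtain ⟨D, hD0, hD⟩ : ∃ D, 0 ≤ D ∧ ∀ ξ, ‖𝓕 f ξ‖ ≤ D := by
    refine ⟨(∫⁻ x, ‖f x‖ₑ).toReal, by positivity, fun ξ => ?_⟩
    rw [← ENNReal.ofReal_le_iff_le_toReal, ofReal_norm]
    · exact enorm_fourier_le _ _
    · exact (hfd.integrable hω).hasFiniteIntegral.ne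
  refine ⟨Real.exp (lam * ω 1) * D + C₃ * Q.toReal * I.toReal * C₁, fun ξ => ?_⟩
  rcases le_total ‖ξ‖ 1 with hξ | hξ
  · have : ω ‖ξ‖ ≤ ω 1 := hω.monotoneOn (norm_nonneg ξ) (zero_le_one' ℝ) hξ
    calc _ ≤ Real.exp (lam * ω 1) * D := by gcongr; exact hD ξ
      _ ≤ _ := le_add_of_nonneg_right (by positivity)
  obtain ⟨k, hk⟩ := hω.exists_powerWeight_mul_exp_le (lam := lam + μ₁) (by positivity) hξ
  obtain ⟨j, hj⟩ := exists_norm_le_mul_abs ξ (by rintro rfl; simp at hξ; linarith)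
  have hWtop : powerWeight ω (lam + μ₁) k ≠ ∞ := by
    have := ne_top_of_le_ne_top ENNReal.ofReal_ne_top hk
    exact (ENNReal.lt_top_of_mul_ne_top_left this (by simp [Real.exp_pos])).ne
  have hltop : powerWeight ω l k ≠ ∞ :=
    ((hω.powerWeight_anti hl _).trans_lt hWtop.lt_top).ne
  have h2 := ENNReal.toReal_mono (ENNReal.mul_ne_top (ENNReal.mul_ne_top hQtop hltop) hI)
    (hfour j k hltop ξ)
  have h3 := ENNReal.toReal_mono (ENNReal.mul_ne_top ENNReal.ofReal_ne_top hWtop) (hW k)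
  have h4 := ENNReal.toReal_mono ENNReal.ofReal_ne_top hk
  have hpi := Real.pi_pos
  rw [ENNReal.toReal_ofReal (by positivity), ENNReal.toReal_mul, ENNReal.toReal_mul] at h2
  rw [ENNReal.toReal_mul, ENNReal.toReal_mul, ENNReal.toReal_ofReal (by positivity),
    ENNReal.toReal_ofReal hC₃.le] at h3
  rw [ENNReal.toReal_mul, ENNReal.toReal_ofReal (by positivity),
    ENNReal.toReal_ofReal (by positivity)] at h4
  generalize (powerWeight ω (lam + μ₁) k).toReal = w at *
  generalize (powerWeight ω l k).toReal = wl at *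
  have h5 : ‖ξ‖ ^ k * ‖𝓕 f ξ‖ ≤ C₃ * Q.toReal * I.toReal * w := by
    calc _ ≤ (N * |ξ j|) ^ k * ‖𝓕 f ξ‖ := by gcongr
      _ = N ^ k * (|ξ j| ^ k * ‖𝓕 f ξ‖) := by ring
      _ ≤ N ^ k * ((2 * Real.pi * |ξ j|) ^ k * ‖𝓕 f ξ‖) := by
          gcongr
          have := Real.pi_gt_three
          nlinarith [abs_nonneg (ξ j)]
      _ ≤ N ^ k * (Q.toReal * wl * I.toReal) := by gcongr
      _ = Q.toReal * I.toReal * (N ^ k * wl) := by ring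
      _ ≤ Q.toReal * I.toReal * (C₃ * w) := by gcongr
      _ = _ := by ring
  have h6 : ‖ξ‖ ^ k * (Real.exp (lam * ω ‖ξ‖) * ‖𝓕 f ξ‖ * Real.exp (μ₁ * ω ‖ξ‖)) ≤
      ‖ξ‖ ^ k * (C₃ * Q.toReal * I.toReal * C₁ * Real.exp (μ₁ * ω ‖ξ‖)) := by
    calc _ = ‖ξ‖ ^ k * ‖𝓕 f ξ‖ * Real.exp ((lam + μ₁) * ω ‖ξ‖) := by
          rw [add_mul, Real.exp_add]; ring
      _ ≤ C₃ * Q.toReal * I.toReal * w * Real.exp ((lam + μ₁) * ω ‖ξ‖) := by gcongr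
      _ = C₃ * Q.toReal * I.toReal * (w * Real.exp ((lam + μ₁) * ω ‖ξ‖)) := by ring
      _ ≤ C₃ * Q.toReal * I.toReal * ‖ξ‖ ^ (k + 1) := by gcongr
      _ = ‖ξ‖ ^ k * (C₃ * Q.toReal * I.toReal * ‖ξ‖) := by ring
      _ ≤ ‖ξ‖ ^ k * (C₃ * Q.toReal * I.toReal * (C₁ * Real.exp (μ₁ * ω ‖ξ‖))) := by
          gcongr
          have := h₁ ‖ξ‖ (norm_nonneg ξ)
          rw [pow_one] at this
          linarith
      _ = _ := by ring
  have h7 := le_of_mul_le_mul_left h6 (by positivity)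
  have h8 := le_of_mul_le_mul_right h7 (Real.exp_pos _)
  exact h8.trans (le_add_of_nonneg_left (by positivity))

theorem hasWeightedDecay_fourier (hω : IsNonQuasianalyticWeight ω) {f : RN N → ℂ}
    (hf : HasFiniteQNorms ω f) : HasWeightedDecay ω (𝓕 f) := by
  refine ⟨(hf.hasWeightedDecay hω).isSmooth_fourier hω, fun μ hμ α => ?_⟩
  induction α using multiIndex_induction generalizing f with
  | zero =>
    rw [mderiv_zero_index]
    exact hf.exists_exp_mul_fourier_le hω hμ
  | add_single α i ih =>
    have hfd := hf.hasWeightedDecay hω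
    have hs := hfd.isSmooth_fourier hω
    rw [mderiv_add_single _ _ hs, ← mderiv_pderivRN _ _ hs, hfd.pderivRN_fourier hω]
    exact ih ((hf.coordRN_mul hω i).const_smul (-(2 * Real.pi * Complex.I)))

end HasFiniteQNorms

/-- `S_ω` consists of the smooth functions with finite norms `q_{lam,μ}`: no condition on the
Fourier transform is needed. -/
theorem memS_iff_hasFiniteQNorms (hω : IsNonQuasianalyticWeight ω) {f : RN N → ℂ} :
    MemS ω N f ↔ HasFiniteQNorms ω f := by
  constructor
  · rintro ⟨-, hs, hsF, h⟩
    have h1 : HasWeightedDecay ω f := ⟨hs, fun μ hμ α => (h μ hμ α).1⟩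
    have h2 : HasWeightedDecay ω (𝓕 f) := ⟨hsF, fun μ hμ α => (h μ hμ α).2⟩
    exact ⟨hs, fun lam μ hlam hμ => h1.qNorm_lt_top hω h2 hlam hμ⟩
  · intro h
    have h1 := h.hasWeightedDecay hω
    have h2 := h.hasWeightedDecay_fourier hω
    exact ⟨h1.integrable hω, h1.1, h2.1, fun lam hlam α => ⟨h1.2 lam hlam α, h2.2 lam hlam α⟩⟩

/-! ### Topologies and continuous seminorms -/

theorem nhds_normTopology {X : Type*} [AddCommGroup X] {p : X → ℝ≥0∞} (h0 : p 0 = 0)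
    (hadd : ∀ x y, p (x + y) ≤ p x + p y) (a : X) :
    @nhds X (normTopology p) a = ⨅ (ε : ℝ≥0∞) (_ : 0 < ε), 𝓟 {x | p (x - a) < ε} := by
  rw [TopologicalSpace.nhds_generateFrom]
  apply le_antisymm
  · refine le_iInf₂ fun ε hε => iInf₂_le_of_le {x | p (x - a) < ε} ⟨?_, a, ε, hε, rfl⟩ le_rfl
    simpa [h0] using hε
  · refine le_iInf₂ ?_
    rintro s ⟨has, c, ε, hε, rfl⟩
    have hac : p (a - c) < ε := has
    refine iInf₂_le_of_le (ε - p (a - c)) (tsub_pos_of_lt hac) (principal_mono.2 fun x hx => ?_)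
    have hx' : p (x - a) + p (a - c) < ε := lt_tsub_iff_right.1 hx
    have := hadd (x - a) (a - c)
    rw [sub_add_sub_cancel] at this
    exact this.trans_lt hx'

theorem SpaceS.toFun_zero : (0 : SpaceS ω N).toFun = 0 := rfl

theorem SpaceS.toFun_add (f g : SpaceS ω N) : (f + g).toFun = f.toFun + g.toFun := rfl

theorem SpaceS.toFun_sub (f g : SpaceS ω N) : (f - g).toFun = f.toFun - g.toFun := rfl

theorem SpaceS.memS (f : SpaceS ω N) : MemS ω N f.toFun := f.2

theorem SpaceS.isSmooth (f : SpaceS ω N) : IsSmooth f.toFun := f.memS.2.1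

theorem SpaceS.tendsto_iff {ι : Type*} {l : Filter ι} {F : ι → SpaceS ω N} {a : SpaceS ω N} :
    Tendsto F l (𝓝 a) ↔ ∀ lam μ : ℝ, 0 < lam → 0 < μ → ∀ ε : ℝ≥0∞, 0 < ε →
      ∀ᶠ i in l, qNorm ω lam μ ((F i).toFun - a.toFun) < ε := by
  have h : 𝓝 a = ⨅ (lam : ℝ) (_ : 0 < lam) (μ : ℝ) (_ : 0 < μ) (ε : ℝ≥0∞) (_ : 0 < ε),
      𝓟 {x : SpaceS ω N | qNorm ω lam μ (x - a).toFun < ε} := by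
    rw [nhds_iInf]
    simp only [nhds_iInf]
    refine iInf_congr fun lam => iInf_congr fun _ => iInf_congr fun μ => iInf_congr fun _ => ?_
    refine nhds_normTopology (X := SpaceS ω N) ?_ (fun x y => ?_) a
    · rw [SpaceS.toFun_zero]
      exact weightedSup_zero ω lam μ
    · rw [SpaceS.toFun_add]
      exact weightedSup_add_le ω lam μ x.isSmooth y.isSmooth
  rw [h]
  simp only [tendsto_iInf, tendsto_principal, mem_ofPred_eq, SpaceS.toFun_sub]
  exact ⟨fun h lam μ hlam hμ => h lam hlam μ hμ, fun h lam hlam μ hμ => h lam μ hlam hμ⟩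

theorem SpaceS.ball_mem_nhds (a : SpaceS ω N) {lam μ : ℝ} (hlam : 0 < lam) (hμ : 0 < μ)
    {ε : ℝ≥0∞} (hε : 0 < ε) : {x : SpaceS ω N | qNorm ω lam μ (x.toFun - a.toFun) < ε} ∈ 𝓝 a :=
  SpaceS.tendsto_iff.1 (tendsto_id (x := 𝓝 a)) lam μ hlam hμ ε hε

theorem exists_topology_of_seminorm {X : Type*} [AddCommGroup X] [Module ℂ X] [Module ℝ X]
    [IsScalarTower ℝ ℂ X] (p : Seminorm ℂ X) : ∃ t : TopologicalSpace X,
      @IsTopologicalAddGroup X t _ ∧ @ContinuousSMul ℂ X _ _ t ∧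
      @LocallyConvexSpace ℝ X _ _ _ _ t ∧
      ∀ (a : X) (U : Set X), U ∈ @nhds X t a ↔ ∃ r > 0, {x | p (x - a) < r} ⊆ U := by
  let q : SeminormFamily ℂ X Unit := fun _ => p
  let t : TopologicalSpace X := q.moduleFilterBasis.topology
  have hq : WithSeminorms q := ⟨rfl⟩
  refine ⟨t, hq.topologicalAddGroup, hq.continuousSMul, hq.toLocallyConvexSpace, fun a U => ?_⟩
  rw [hq.mem_nhds_iff]
  constructor
  · rintro ⟨s, r, hr, h⟩
    refine ⟨r, hr, Subset.trans (fun x hx => ?_) h⟩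
    rw [Seminorm.mem_ball]
    exact (Seminorm.finset_sup_apply_lt hr fun _ _ => hx)
  · rintro ⟨r, hr, h⟩
    refine ⟨{()}, r, hr, Subset.trans (fun x hx => ?_) h⟩
    simpa [Seminorm.mem_ball, q] using hx

/-- A seminorm that is continuous on each step is continuous for the locally convex inductive limit
topology, because its own topology is one of those whose supremum is taken. -/
theorem ball_mem_nhds_lcInductiveTopology {ι X : Type*} {Y : ι → Type*} [AddCommGroup X]
    [Module ℂ X] [Module ℝ X] [IsScalarTower ℝ ℂ X] (tY : ∀ n, TopologicalSpace (Y n))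
    (j : ∀ n, Y n → X) (p : Seminorm ℂ X)
    (hp : ∀ n y, ∀ r > 0, {z | p (j n z - j n y) < r} ∈ @nhds _ (tY n) y) (a : X) {r : ℝ}
    (hr : 0 < r) : {x | p (x - a) < r} ∈ @nhds X (lcInductiveTopology tY j) a := by
  obtain ⟨t, h1, h2, h3, h4⟩ := exists_topology_of_seminorm p
  have hle : lcInductiveTopology tY j ≤ t := by
    refine sInf_le ⟨h1, h2, h3, fun n => ?_⟩
    rw [continuous_iff_continuousAt]
    intro y U hU
    obtain ⟨r, hr, h⟩ := (h4 _ U).1 hU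
    exact mem_of_superset (hp n y r hr) fun z hz => h hz
  exact nhds_mono hle ((h4 a _).2 ⟨r, hr, Subset.rfl⟩)

theorem SpaceOm.isSmooth (hω : IsNonQuasianalyticWeight ω) {m : ℕ+} (f : SpaceOm ω N m) :
    IsSmooth f.1 := by
  obtain ⟨n, hn⟩ := (mem_subOm hω.nonneg N m f.1).1 f.2
  exact hn.1

theorem SpaceOM.exists_rNorm_lt_top (hω : IsNonQuasianalyticWeight ω) (f : SpaceOM ω N) (m : ℕ+) :
    IsSmooth f.toFun ∧ ∃ n : ℕ+, rNorm ω m n f.toFun < ∞ := by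
  obtain ⟨n, hn⟩ := (mem_subOm hω.nonneg N m f.1).1 (inclOM ω N m f).2
  exact ⟨hn.1, n, hn.2⟩

theorem SpaceOM.isSmooth (hω : IsNonQuasianalyticWeight ω) (f : SpaceOM ω N) :
    IsSmooth f.toFun := (f.exists_rNorm_lt_top hω 1).1

/-- A seminorm on `O^m_ω` (given as an extended seminorm on smooth functions) that is dominated by
a multiple of `r_{m,n}` for every `n` is continuous: its topology is one of those whose supremum is
the inductive limit topology. -/
theorem SpaceOm.ball_mem_nhds (hω : IsNonQuasianalyticWeight ω) (m : ℕ+)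
    {P : (RN N → ℂ) → ℝ≥0∞}
    (hadd : ∀ f g, IsSmooth f → IsSmooth g → P (f + g) ≤ P f + P g)
    (hsmul : ∀ (c : ℂ) (f), IsSmooth f → P (c • f) = ‖c‖ₑ * P f)
    (hP : ∀ n : ℕ+, ∃ C : ℝ≥0∞, C ≠ ∞ ∧ ∀ f, IsSmooth f → P f ≤ C * rNorm ω m n f)
    (a : SpaceOm ω N m) {ε : ℝ≥0∞} (hε : 0 < ε) :
    {f : SpaceOm ω N m | P (f.1 - a.1) < ε} ∈ 𝓝 a := by
  have hfin : ∀ f : SpaceOm ω N m, P f.1 ≠ ∞ := by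
    intro f
    obtain ⟨n, hn⟩ := (mem_subOm hω.nonneg N m f.1).1 f.2
    obtain ⟨C, hC, h⟩ := hP n
    exact ((h f.1 hn.1).trans_lt (ENNReal.mul_lt_top hC.lt_top hn.2)).ne
  let p : Seminorm ℂ (SpaceOm ω N m) := Seminorm.of (fun f => (P f.1).toReal)
    (fun f g => by
      rw [← ENNReal.toReal_add (hfin f) (hfin g)]
      exact ENNReal.toReal_mono (ENNReal.add_ne_top.2 ⟨hfin f, hfin g⟩)
        (hadd _ _ (f.isSmooth hω) (g.isSmooth hω)))
    (fun c f => by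
      change (P (c • f.1)).toReal = _
      rw [hsmul c _ (f.isSmooth hω), ENNReal.toReal_mul, toReal_enorm])
  obtain ⟨r, hr0, hrε⟩ := ENNReal.lt_iff_exists_nnreal_btwn.1 hε
  have hr : (0 : ℝ) < r := by exact_mod_cast hr0
  have hlt : ∀ (f : SpaceOm ω N m) {s : ℝ}, p f < s ↔ P f.1 < ENNReal.ofReal s := by
    intro f s
    rw [ENNReal.lt_ofReal_iff_toReal_lt (hfin f)]
    rfl
  refine mem_of_superset (ball_mem_nhds_lcInductiveTopology _ _ p (fun n y s hs => ?_) a hr)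
    fun f hf => ?_
  · obtain ⟨C, hC, h⟩ := hP n
    have hδ : 0 < ENNReal.ofReal s / (C + 1) :=
      ENNReal.div_pos (ENNReal.ofReal_pos.2 hs).ne' (ENNReal.add_ne_top.2 ⟨hC, ENNReal.one_ne_top⟩)
    have hn : 𝓝 y = ⨅ (ε : ℝ≥0∞) (_ : 0 < ε),
        𝓟 {z : SpaceOmn ω N m n | rNorm ω m n (z - y).1 < ε} :=
      nhds_normTopology (X := SpaceOmn ω N m n) (p := fun f => rNorm ω m n f.1)
        (by
          change rNorm ω m n (0 : RN N → ℂ) = 0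
          exact weightedSup_zero ω _ _)
        (fun f g => by
          change rNorm ω m n (f.1 + g.1) ≤ _
          exact weightedSup_add_le ω _ _ f.2.1 g.2.1) y
    have hball : {z : SpaceOmn ω N m n | rNorm ω m n (z - y).1 < ENNReal.ofReal s / (C + 1)} ∈
        𝓝 y := by
      rw [hn]
      exact mem_iInf_of_mem _ (mem_iInf_of_mem hδ (mem_principal_self _))
    refine mem_of_superset hball fun z hz => ?_
    change p (inclOmn ω N m n z - inclOmn ω N m n y) < s
    rw [hlt]
    calc P (z - y).1 ≤ C * rNorm ω m n (z - y).1 := h _ (z - y).2.1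
      _ ≤ (C + 1) * rNorm ω m n (z - y).1 := by gcongr; exact le_self_add
      _ < _ := ENNReal.mul_lt_of_lt_div' hz
  · have : P (f - a).1 < ENNReal.ofReal r := (hlt _).1 hf
    rw [ENNReal.ofReal_coe_nnreal] at this
    exact this.trans hrε

/-- The version of `SpaceOm.ball_mem_nhds` for the projective limit `O_{M,ω}`. -/
theorem SpaceOM.ball_mem_nhds (hω : IsNonQuasianalyticWeight ω) (m : ℕ+)
    {P : (RN N → ℂ) → ℝ≥0∞}
    (hadd : ∀ f g, IsSmooth f → IsSmooth g → P (f + g) ≤ P f + P g)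
    (hsmul : ∀ (c : ℂ) (f), IsSmooth f → P (c • f) = ‖c‖ₑ * P f)
    (hP : ∀ n : ℕ+, ∃ C : ℝ≥0∞, C ≠ ∞ ∧ ∀ f, IsSmooth f → P f ≤ C * rNorm ω m n f)
    (a : SpaceOM ω N) {ε : ℝ≥0∞} (hε : 0 < ε) :
    {f : SpaceOM ω N | P (f.toFun - a.toFun) < ε} ∈ 𝓝 a := by
  have hc : Continuous (inclOM ω N m) := continuous_iInf_dom continuous_induced_dom
  exact hc.continuousAt (SpaceOm.ball_mem_nhds hω m hadd hsmul hP (inclOM ω N m a) hε)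

/-! ### Bounded sets and regularity of the inductive limits -/

theorem exists_forall_le_of_isVonNBounded {E : Type*} [AddCommGroup E] [Module ℂ E]
    [TopologicalSpace E] {P : E → ℝ≥0∞} (hsmul : ∀ (c : ℂ) (x), P (c • x) = ‖c‖ₑ * P x)
    (hP : {x | P x < 1} ∈ 𝓝 (0 : E)) {B : Set E} (hB : Bornology.IsVonNBounded ℂ B) :
    ∃ C : ℝ≥0∞, C ≠ ∞ ∧ ∀ x ∈ B, P x ≤ C := by
  obtain ⟨c, hc⟩ := (hB hP).exists
  refine ⟨‖c‖ₑ, enorm_ne_top, fun x hx => ?_⟩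
  obtain ⟨y, hy, rfl⟩ := hc hx
  change P (c • y) ≤ _
  rw [hsmul]
  calc _ ≤ ‖c‖ₑ * 1 := mul_le_mul_right (le_of_lt hy) _
    _ = _ := mul_one _

theorem SpaceS.exists_qNorm_le_of_isVonNBounded {B : Set (SpaceS ω N)}
    (hB : Bornology.IsVonNBounded ℂ B) {lam μ : ℝ} (hlam : 0 < lam) (hμ : 0 < μ) :
    ∃ C : ℝ≥0∞, C ≠ ∞ ∧ ∀ g ∈ B, qNorm ω lam μ g.toFun ≤ C := by
  refine exists_forall_le_of_isVonNBounded (P := fun g : SpaceS ω N => qNorm ω lam μ g.toFun)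
    (fun c g => weightedSup_smul ω lam μ c g.isSmooth) ?_ hB
  refine mem_of_superset (SpaceS.ball_mem_nhds 0 hlam hμ zero_lt_one) fun g hg => ?_
  have : qNorm ω lam μ (g - 0).toFun < 1 := hg
  rwa [sub_zero] at this

/-- Regularity of the inductive limits: a bounded subset of `O_{M,ω}` is, for each `m`, bounded in
some step `O^m_{n,ω}`. If it were not, point evaluations of derivatives witnessing the failure for
all `n` would make up a continuous seminorm that is unbounded on the set. -/
theorem SpaceOM.exists_rNorm_le_of_isVonNBounded (hω : IsNonQuasianalyticWeight ω)
    {A : Set (SpaceOM ω N)} (hA : Bornology.IsVonNBounded ℂ A) (m : ℕ+) :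
    ∃ n : ℕ+, ∃ C : ℝ≥0∞, C ≠ ∞ ∧ ∀ f ∈ A, rNorm ω m n f.toFun ≤ C := by
  by_contra! hc
  have hm : (0 : ℝ) < (m : ℕ) := by exact_mod_cast m.pos
  set T : ℕ+ → (Fin N → ℕ) → RN N → (RN N → ℂ) → ℝ≥0∞ := fun n α x f => ‖mderiv α f x‖ₑ *
    ENNReal.ofReal (Real.exp (-((n : ℕ) : ℝ) * ω ‖x‖)) / powerWeight ω (m : ℕ) (∑ i, α i) with hT
  have hr : ∀ n f, rNorm ω m n f = ⨆ (α : Fin N → ℕ) (x : RN N), T n α x f := fun n f =>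
    weightedSup_eq ω hm _ f
  have hwit : ∀ n : ℕ+, ∃ f ∈ A, ∃ α x, ((n : ℕ) : ℝ≥0∞) < T n α x f.toFun := by
    intro n
    obtain ⟨f, hf, h⟩ := hc n ((n : ℕ) : ℝ≥0∞) (ENNReal.natCast_ne_top _)
    rw [hr] at h
    obtain ⟨α, h⟩ := lt_iSup_iff.1 h
    obtain ⟨x, h⟩ := lt_iSup_iff.1 h
    exact ⟨f, hf, α, x, h⟩
  choose f hfA α x hfx using hwit
  have hsmul : ∀ (c : ℂ) (g : RN N → ℂ), IsSmooth g →
      (⨆ n, T n (α n) (x n) (c • g)) = ‖c‖ₑ * ⨆ n, T n (α n) (x n) g := by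
    intro c g hg
    rw [ENNReal.mul_iSup]
    refine iSup_congr fun n => ?_
    simp only [hT, mderiv_smul _ c hg, Pi.smul_apply, enorm_smul, mul_div_assoc, mul_assoc]
  have hnhds := SpaceOM.ball_mem_nhds hω m (P := fun g => ⨆ n, T n (α n) (x n) g)
    (fun g h hg hh => by
      refine iSup_le fun n => ?_
      calc T n (α n) (x n) (g + h) ≤ T n (α n) (x n) g + T n (α n) (x n) h := by
            simp only [hT, mderiv_add _ hg hh, Pi.add_apply]
            rw [← ENNReal.add_div, ← add_mul]
            gcongr
            exact enorm_add_le _ _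
        _ ≤ _ := add_le_add (le_iSup (fun n => T n (α n) (x n) g) n)
            (le_iSup (fun n => T n (α n) (x n) h) n))
    hsmul
    (fun k => by
      -- for `n ≥ k` the term is at most `r_{m,k}`; the finitely many others cost a constant each
      refine ⟨1 + ∑ n ∈ Finset.Iio k,
        ENNReal.ofReal (Real.exp (((k : ℕ) : ℝ) * ω ‖x n‖)), ?_, fun g hg => iSup_le fun n => ?_⟩
      · refine ENNReal.add_ne_top.2 ⟨ENNReal.one_ne_top, ?_⟩
        exact ENNReal.sum_ne_top.2 fun n _ => ENNReal.ofReal_ne_top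
      have hle : ∀ n, T n (α n) (x n) g ≤ rNorm ω m n g := fun n => by
        rw [hr]
        exact le_iSup₂ (f := fun α x => T n α x g) (α n) (x n)
      rw [add_mul, one_mul]
      rcases le_or_gt k n with hkn | hkn
      · exact ((hle n).trans (rNorm_anti hω.nonneg m hkn g)).trans le_self_add
      · refine le_trans ?_ le_add_self
        calc T n (α n) (x n) g ≤ ENNReal.ofReal (Real.exp (((k : ℕ) : ℝ) * ω ‖x n‖)) *
              T k (α n) (x n) g := by
              simp only [hT]
              rw [← mul_div_assoc]
              refine ENNReal.div_le_div_right ?_ _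
              rw [mul_left_comm, ← ENNReal.ofReal_mul (Real.exp_pos _).le, ← Real.exp_add]
              gcongr
              have h0 := hω.nonneg ‖x n‖ (norm_nonneg _)
              have hn0 : (0 : ℝ) ≤ (n : ℕ) := by positivity
              nlinarith
          _ ≤ ENNReal.ofReal (Real.exp (((k : ℕ) : ℝ) * ω ‖x n‖)) * rNorm ω m k g := by
              refine mul_le_mul_right ?_ _
              rw [hr]
              exact le_iSup₂ (f := fun α x => T k α x g) (α n) (x n)
          _ ≤ _ := by
              refine mul_le_mul_left ?_ _
              exact Finset.single_le_sum
                (f := fun n => ENNReal.ofReal (Real.exp (((k : ℕ) : ℝ) * ω ‖x n‖)))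
                (fun _ _ => zero_le) (Finset.mem_Iio.2 hkn))
    (0 : SpaceOM ω N) zero_lt_one
  obtain ⟨C, hC, h⟩ := exists_forall_le_of_isVonNBounded
    (P := fun g : SpaceOM ω N => ⨆ n, T n (α n) (x n) g.toFun)
    (fun c g => hsmul c g.toFun (g.isSmooth hω))
    (mem_of_superset hnhds fun g hg => by
      have : (⨆ n, T n (α n) (x n) (g - 0).toFun) < 1 := hg
      rwa [sub_zero] at this) hA
  obtain ⟨n, hn⟩ := ENNReal.exists_nat_gt hC
  have h1 := hfx ⟨n + 1, Nat.succ_pos n⟩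
  have h2 := (le_iSup (fun k => T k (α k) (x k) (f ⟨n + 1, Nat.succ_pos n⟩).toFun)
    ⟨n + 1, Nat.succ_pos n⟩).trans (h _ (hfA _))
  have h3 := (h1.trans_le h2).trans hn
  simp only [PNat.mk_coe, Nat.cast_lt] at h3
  omega

/-! ### The multiplication map -/

/-- The multiplication map `O_{M,ω} × S_ω → S_ω`. -/
def mulOMS (hω : IsNonQuasianalyticWeight ω) :
    SpaceOM ω N →ₗ[ℂ] SpaceS ω N →ₗ[ℂ] SpaceS ω N :=
  LinearMap.mk₂ ℂ
    (fun f g => ⟨f.toFun * g.toFun, (memS_iff_hasFiniteQNorms hω).2 <|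
      HasFiniteQNorms.mul_left hω (f.isSmooth hω)
        (fun m => by
          obtain ⟨n, hn⟩ := (f.exists_rNorm_lt_top hω m).2
          exact ⟨((n : ℕ) : ℝ), by positivity, hn⟩)
        ((memS_iff_hasFiniteQNorms hω).1 g.memS)⟩)
    (fun f f' g => Subtype.ext (add_mul f.toFun f'.toFun g.toFun))
    (fun c f g => Subtype.ext (smul_mul_assoc c f.toFun g.toFun))
    (fun f g g' => Subtype.ext (mul_add f.toFun g.toFun g'.toFun))
    (fun c f g => Subtype.ext (mul_smul_comm c f.toFun g.toFun))

theorem toFun_mulOMS (hω : IsNonQuasianalyticWeight ω) (f : SpaceOM ω N) (g : SpaceS ω N) :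
    (mulOMS hω f g).toFun = f.toFun * g.toFun := rfl

theorem isEquicontinuousSet_of_eventually {E : Type*} [AddCommGroup E] [Module ℂ E]
    [TopologicalSpace E] {H : Set (E →ₗ[ℂ] SpaceS ω N)}
    (h : ∀ lam μ : ℝ, 0 < lam → 0 < μ → ∀ ε : ℝ≥0∞, 0 < ε → ∀ a : E, ∀ᶠ x in 𝓝 a, ∀ T ∈ H,
      qNorm ω lam μ ((T x).toFun - (T a).toFun) < ε) : IsEquicontinuousSet H := by
  refine ⟨fun T hT => continuous_iff_continuousAt.2 fun a => ?_, fun V hV => ?_⟩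
  · refine SpaceS.tendsto_iff.2 fun lam μ hlam hμ ε hε => ?_
    exact (h lam μ hlam hμ ε hε a).mono fun x hx => hx T hT
  · have ht : Tendsto (fun p : (E →ₗ[ℂ] SpaceS ω N) × E => p.1 p.2) (𝓟 H ×ˢ 𝓝 0) (𝓝 0) := by
      refine SpaceS.tendsto_iff.2 fun lam μ hlam hμ ε hε => ?_
      refine mem_of_superset (prod_mem_prod (mem_principal_self H) (h lam μ hlam hμ ε hε 0)) ?_
      rintro ⟨T, x⟩ ⟨hT, hx⟩
      have := hx T hT
      rw [map_zero] at this
      exact this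
    obtain ⟨s, hs, U, hU, hsU⟩ := mem_prod_iff.1 (ht hV)
    exact ⟨U, hU, fun T hT x hx => hsU (mk_mem_prod (hs hT) hx)⟩

theorem exists_qNorm_mul_le (hω : IsNonQuasianalyticWeight ω) (N : ℕ) {lam : ℝ}
    (hlam : 0 < lam) : ∃ m : ℕ+, ∃ C : ℝ≥0∞, C ≠ ∞ ∧ ∀ (n : ℕ+) (μ : ℝ) (f g : RN N → ℂ),
      IsSmooth f → IsSmooth g →
        qNorm ω lam μ (f * g) ≤ C * (rNorm ω m n f * qNorm ω (m : ℕ) (n + μ) g) := by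
  obtain ⟨m₀, C, hC, h⟩ := exists_weightedSup_mul_le (N := N) hω hlam
  obtain ⟨m, hm⟩ := exists_nat_ge m₀
  refine ⟨⟨m + 1, Nat.succ_pos m⟩, C, hC, fun n μ f g hf hg => ?_⟩
  have h1 := h ((m + 1 : ℕ) : ℝ) (by push_cast; linarith) (by positivity) (-((n : ℕ) : ℝ))
    (((n : ℕ) : ℝ) + μ) f g hf hg
  rw [neg_add_cancel_left] at h1
  exact h1

theorem isEquicontinuousSet_mulOMS_left (hω : IsNonQuasianalyticWeight ω)
    {A : Set (SpaceOM ω N)}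
    (hA : ∀ m : ℕ+, ∃ n : ℕ+, ∃ C : ℝ≥0∞, C ≠ ∞ ∧ ∀ f ∈ A, rNorm ω m n f.toFun ≤ C) :
    IsEquicontinuousSet {T | ∃ f ∈ A, T = mulOMS hω f} := by
  refine isEquicontinuousSet_of_eventually fun lam μ hlam hμ ε hε a => ?_
  obtain ⟨m, C, hC, h⟩ := exists_qNorm_mul_le hω N hlam
  obtain ⟨n, D, hD, hn⟩ := hA m
  have hδ : 0 < ε / (C * D + 1) :=
    ENNReal.div_pos hε.ne' (ENNReal.add_ne_top.2 ⟨ENNReal.mul_ne_top hC hD, ENNReal.one_ne_top⟩)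
  filter_upwards [SpaceS.ball_mem_nhds a (lam := (m : ℕ)) (μ := n + μ)
    (by exact_mod_cast m.pos) (by positivity) hδ]
  rintro g hg _ ⟨f, hf, rfl⟩
  rw [toFun_mulOMS, toFun_mulOMS, ← mul_sub]
  calc _ ≤ C * (rNorm ω m n f.toFun * qNorm ω (m : ℕ) (n + μ) (g.toFun - a.toFun)) :=
        h n μ _ _ (f.isSmooth hω) (g.isSmooth.sub a.isSmooth)
    _ ≤ (C * D + 1) * qNorm ω (m : ℕ) (n + μ) (g.toFun - a.toFun) := by
        rw [← mul_assoc]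
        gcongr
        exact (mul_le_mul_right (hn f hf) _).trans le_self_add
    _ < ε := ENNReal.mul_lt_of_lt_div' hg

theorem isEquicontinuousSet_mulOMS_right (hω : IsNonQuasianalyticWeight ω)
    {B : Set (SpaceS ω N)} (hB : ∀ lam μ : ℝ, 0 < lam → 0 < μ →
      ∃ C : ℝ≥0∞, C ≠ ∞ ∧ ∀ g ∈ B, qNorm ω lam μ g.toFun ≤ C) :
    IsEquicontinuousSet {T | ∃ g ∈ B, T = (mulOMS hω).flip g} := by
  refine isEquicontinuousSet_of_eventually fun lam μ hlam hμ ε hε a => ?_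
  obtain ⟨m, C, hC, h⟩ := exists_qNorm_mul_le hω N hlam
  have hball := SpaceOM.ball_mem_nhds hω m
    (P := fun f => ⨆ (g : SpaceS ω N) (_ : g ∈ B), qNorm ω lam μ (f * g.toFun))
    (fun f f' hf hf' => iSup₂_le fun g hg => by
      rw [add_mul]
      refine (weightedSup_add_le ω lam μ (hf.mul g.isSmooth) (hf'.mul g.isSmooth)).trans ?_
      exact add_le_add
        (le_iSup₂ (f := fun (g : SpaceS ω N) (_ : g ∈ B) => qNorm ω lam μ (f * g.toFun)) g hg)
        (le_iSup₂ (f := fun (g : SpaceS ω N) (_ : g ∈ B) => qNorm ω lam μ (f' * g.toFun)) g hg))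
    (fun c f hf => by
      simp only [ENNReal.mul_iSup]
      refine iSup_congr fun g => iSup_congr fun _ => ?_
      rw [smul_mul_assoc]
      exact weightedSup_smul ω lam μ c (hf.mul g.isSmooth))
    (fun n => by
      obtain ⟨D, hD, hD'⟩ := hB (m : ℕ) (n + μ) (by exact_mod_cast m.pos) (by positivity)
      refine ⟨C * D, ENNReal.mul_ne_top hC hD, fun f hf => iSup₂_le fun g hg => ?_⟩
      refine (h n μ f g.toFun hf g.isSmooth).trans ?_
      rw [mul_assoc, mul_comm D]
      gcongr
      exact hD' g hg)
    a hε
  filter_upwards [hball]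
  rintro f hf _ ⟨g, hg, rfl⟩
  rw [LinearMap.flip_apply, LinearMap.flip_apply, toFun_mulOMS, toFun_mulOMS, ← sub_mul]
  exact (le_iSup₂ (f := fun (g : SpaceS ω N) (_ : g ∈ B) =>
    qNorm ω lam μ ((f.toFun - a.toFun) * g.toFun)) g hg).trans_lt hf

end

theorem proposition4p1 (N : ℕ) (ω : ℝ → ℝ) (hω : IsNonQuasianalyticWeight ω) :
    ∃ M : SpaceOM ω N →ₗ[ℂ] SpaceS ω N →ₗ[ℂ] SpaceS ω N,
      (∀ (f : SpaceOM ω N) (g : SpaceS ω N) (x : RN N),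
        (M f g).toFun x = f.toFun x * g.toFun x) ∧
      IsSeparatelyContinuous M ∧ IsHypocontinuous M := by
  refine ⟨mulOMS hω, fun f g x => rfl, ⟨fun f => ?_, fun g => ?_⟩, fun A hA => ?_, fun B hB => ?_⟩
  · refine (isEquicontinuousSet_mulOMS_left hω (A := {f}) fun m => ?_).1 _ ⟨f, rfl, rfl⟩
    obtain ⟨n, hn⟩ := (f.exists_rNorm_lt_top hω m).2
    exact ⟨n, _, hn.ne, by simp⟩
  · refine (isEquicontinuousSet_mulOMS_right hω (B := {g}) fun lam μ hlam hμ => ?_).1 _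
      ⟨g, rfl, rfl⟩
    have := ((memS_iff_hasFiniteQNorms hω).1 g.memS).2 lam μ hlam hμ
    exact ⟨_, this.ne, by simp⟩
  · exact isEquicontinuousSet_mulOMS_left hω fun m =>
      SpaceOM.exists_rNorm_le_of_isVonNBounded hω hA m
  · exact isEquicontinuousSet_mulOMS_right hω fun lam μ hlam hμ =>
      SpaceS.exists_qNorm_le_of_isVonNBounded hB hlam hμ
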